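/- **Setting.** Let $\Omega_2\subset\mathbb R^2$ be a nonempty bounded open convex set, $\delta>0$, and let $D$ be such that $\Omega_2\subset B_D(0)$ (closed disc). Put $\Lambda=B_D(0)\times[-\tfrac1\delta,-\delta]$, $\Omega_\infty=\Omega_2\times[0,\infty)$, $\Omega_H=\Omega_2\times[0,H]$, and assume $$H>\frac{2}{\mathcal L^2(\Omega_2)}+\frac{2\sup_{x\in\Omega_2}|x|+\max_{y\in\Lambda}(|y_1|+|y_2|)}{\delta}\,\operatorname{diam}\Omega_2 .$$ Let $\nu$ be a Borel probability measure on $\mathbb R^3$ with $\operatorname{supp}\nu\subset\Lambda$. For $h:\Omega_2\to[0,\infty)$ let $\Omega_h=\{x\in\Omega_\infty: 0<x_3<h(x_1,x_2)\}$ and let $\sigma_h$ be the measure with density $\chi_{\Omega_h}$ with respect to $\mathcal L^3$. Let $\mathcal M_\nu$ be the set of pairs $(h,\gamma)$ such that $h\ge0$ is continuous on $\Omega_2$, $\int_{\Omega_2}h=1$, and $\gamma$ is a Borel measure on $\mathbb R^3\times\mathbb R^3$ with marginals $\sigma_h$ and $\nu$. For $(h,\gamma)\in\mathcal M_\nu$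 let $$E_\nu(h,\gamma)=\int\Big[\tfrac12\big((x_1-y_1)^2+(x_2-y_2)^2\big)-x_3y_3\Big]\,d\gamma(x,y)\in[0,\infty].$$ Let $\mathcal N_\nu$ be the set of pairs $(P,R)$ of real-valued functions on $\Omega_H$ and $\Lambda$, measurable with respect to $\mathcal L^3$ and $\nu$ respectively, with $P(x)+R(y)\ge x\cdot y$ for all $x\in\Omega_H$, $y\in\Lambda$. For such pairs let $$J^H_\nu(P,R)=\int_\Lambda\big[\tfrac12(y_1^2+y_2^2)-R(y)\big]\,d\nu(y)+\inf_{0\le h\le H}\int\big[\tfrac12(x_1^2+x_2^2)-P(x)\big]\sigma_h(x)\,dx\in[-\infty,\infty),$$ the infimum being over measurable $h:\Omega_2\to[0,H]$. Call $(P,R)$ convex conjugate if $P(x)=\sup_{y\in\Lambda}(x\cdot y-R(y))$ for all $x\in\Omega_H$ and $R(y)=\sup_{x\in\Omega_H}(x\cdot y-P(x))$ for all $y\in\Lambda$. For a convex conjugate pair and $(x_1,x_2)\in\Omega_2$, let $h^H_P(x_1,x_2)$ be the unique point of $[0,H]$ at which $s\mapsto\int_0^s[\tfrac12(x_1^2+x_2^2)-P(x_1,x_2,t)]\,dt$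 attains its minimum over $[0,H]$. **Theorem.** (i) $E_\nu(h,\gamma)\ge J^H_\nu(P,R)$ for all $(h,\gamma)\in\mathcal M_\nu$ and all $(P,R)\in\mathcal N_\nu$. (ii) Let $(P,R)$ be a convex conjugate pair that maximizes $J^H_\nu$ over $\mathcal N_\nu$. Then a pair $(h,\gamma)$ belongs to $\mathcal M_\nu$ and satisfies $E_\nu(h,\gamma)=J^H_\nu(P,R)$ if and only if $h=h^H_P$ on $\Omega_2$ and $\gamma=(\mathrm{id}\times\nabla P)_\sharp\sigma_h$. (iii) If moreover $\nu\ll\mathcal L^3$, then $\nabla R_\sharp\nu=\sigma_h$, where $h=h^H_P$. -/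

import Mathlib

open MeasureTheory Set

namespace Geostrophic

/-- The horizontal plane `ℝ²`, with the Euclidean norm. -/
abbrev E2 : Type := EuclideanSpace ℝ (Fin 2)

/-- The space `ℝ³`, with the Euclidean norm. -/
abbrev E3 : Type := EuclideanSpace ℝ (Fin 3)

/-- The horizontal part `(x₁, x₂)` of `x = (x₁, x₂, x₃)`. -/
noncomputable def horiz (x : E3) : E2 := !₂[x 0, x 1]

/-- The point `(x₁, x₂, s)` at height `s` above `(x₁, x₂)`. -/
noncomputable def lift (x : E2) (s : ℝ) : E3 := !₂[x 0, x 1, s]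

/-- The cylinder `A × I ⊆ ℝ² × ℝ = ℝ³`. -/
def cylinder (A : Set E2) (I : Set ℝ) : Set E3 := {x | horiz x ∈ A ∧ x 2 ∈ I}

/-- `Ω_H = Ω₂ × [0, H]`. -/
def OmegaH (Ω : Set E2) (H : ℝ) : Set E3 := cylinder Ω (Icc 0 H)

/-- `Λ = B_D(0) × [-1/δ, -δ]`, with the closed disc `B_D(0)`. -/
def Lam (D δ : ℝ) : Set E3 := cylinder (Metric.closedBall 0 D) (Icc (-(1 / δ)) (-δ))

/-- `Ω_h = {x | (x₁, x₂) ∈ Ω₂, 0 < x₃ < h(x₁, x₂)}`. -/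
def subgraph (Ω : Set E2) (h : E2 → ℝ) : Set E3 :=
  {x | horiz x ∈ Ω ∧ 0 < x 2 ∧ x 2 < h (horiz x)}

/-- `σ_h`, the measure with density `χ_{Ω_h}` with respect to Lebesgue measure. -/
noncomputable def sigma (Ω : Set E2) (h : E2 → ℝ) : Measure E3 :=
  volume.restrict (subgraph Ω h)

/-- The integral `∫ f dμ` as an extended real number, positive part minus negative part. It is
used only where at least one of the two parts has finite integral. -/
noncomputable def extIntegral {X : Type*} [MeasurableSpace X] (μ : Measure X) (f : X → ℝ) :
    EReal :=
  ((∫⁻ x, ENNReal.ofReal (f x) ∂μ : ENNReal) : EReal) -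
    ((∫⁻ x, ENNReal.ofReal (-f x) ∂μ : ENNReal) : EReal)

/-- The cost `c(x, y) = ½[(x₁ - y₁)² + (x₂ - y₂)²] - x₃ y₃`. -/
noncomputable def cost (x y : E3) : ℝ :=
  (1 / 2) * ((x 0 - y 0) ^ 2 + (x 1 - y 1) ^ 2) - x 2 * y 2

/-- `(h, γ) ∈ M_ν`: the function `h` is nonnegative and continuous on `Ω₂` with `∫_{Ω₂} h = 1`,
and `γ` has marginals `σ_h` and `ν`. Only the values of `h` on `Ω₂` matter. -/
structure Admissible (Ω : Set E2) (ν : Measure E3) (h : E2 → ℝ) (γ : Measure (E3 × E3)) :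
    Prop where
  nonneg : ∀ x ∈ Ω, 0 ≤ h x
  continuousOn : ContinuousOn h Ω
  integral_eq : ∫ x in Ω, h x = 1
  fst_eq : γ.fst = sigma Ω h
  snd_eq : γ.snd = ν

/-- The geostrophic functional `E_ν(h, γ) = ∫ c dγ`. On admissible pairs, with `ν` supported in
`Λ`, the cost is nonnegative almost everywhere, so that the value lies in `[0, ∞]`. -/
noncomputable def energy (γ : Measure (E3 × E3)) : EReal :=
  extIntegral γ (fun p => cost p.1 p.2)

/-- `(P, R) ∈ N_ν`: `P(x) + R(y) ≥ x · y` for `x ∈ Ω_H`, `y ∈ Λ`, where `P` and `R` are real-valued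
and measurable. Only the values of `P` on `Ω_H` and of `R` on `Λ` matter. -/
structure DualAdmissible (Ω : Set E2) (H : ℝ) (L : Set E3) (ν : Measure E3) (P R : E3 → ℝ) :
    Prop where
  aemeasurable_left : AEMeasurable P (volume.restrict (OmegaH Ω H))
  aemeasurable_right : AEMeasurable R (ν.restrict L)
  inner_le : ∀ x ∈ OmegaH Ω H, ∀ y ∈ L, inner ℝ x y ≤ P x + R y

/-- The dual functional
`J_ν^H(P, R) = ∫_Λ [½(y₁² + y₂²) - R] dν + inf_{0 ≤ h ≤ H} ∫ [½(x₁² + x₂²) - P] σ_h dx`.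
The infimum runs over the measurable `h`. For pairs in `N_ν` both `P` and `R` are bounded below on
bounded sets, so all integrals are well defined in `[-∞, ∞)`. -/
noncomputable def dual (Ω : Set E2) (H : ℝ) (L : Set E3) (ν : Measure E3) (P R : E3 → ℝ) :
    EReal :=
  extIntegral (ν.restrict L) (fun y => (1 / 2) * (y 0 ^ 2 + y 1 ^ 2) - R y) +
    ⨅ h ∈ {h : E2 → ℝ | Measurable h ∧ ∀ x ∈ Ω, 0 ≤ h x ∧ h x ≤ H},
      extIntegral (sigma Ω h) (fun x => (1 / 2) * (x 0 ^ 2 + x 1 ^ 2) - P x)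

/-- `f` on `A` and `g` on `B` are convex conjugate to each other. -/
def ConvexConjugate (A B : Set E3) (f g : E3 → ℝ) : Prop :=
  (∀ x ∈ A, IsLUB ((fun y => inner ℝ x y - g y) '' B) (f x)) ∧
    ∀ y ∈ B, IsLUB ((fun x => inner ℝ x y - f x) '' A) (g y)

/-- `(P, R)` is a maximizer of `J_ν^H` over `N_ν`. -/
def IsDualMaximizer (Ω : Set E2) (H : ℝ) (L : Set E3) (ν : Measure E3) (P R : E3 → ℝ) : Prop :=
  DualAdmissible Ω H L ν P R ∧
    ∀ P' R' : E3 → ℝ, DualAdmissible Ω H L ν P' R' → dual Ω H L ν P' R' ≤ dual Ω H L ν P R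

/-- `Π_P(x₁, x₂, s) = ∫₀ˢ [½(x₁² + x₂²) - P(x₁, x₂, t)] dt`. -/
noncomputable def columnEnergy (P : E3 → ℝ) (x : E2) (s : ℝ) : ℝ :=
  ∫ t in (0 : ℝ)..s, ((1 / 2) * (x 0 ^ 2 + x 1 ^ 2) - P (lift x t))

/-- `h_P^H(x₁, x₂)`: the point of `[0, H]` at which `Π_P(x₁, x₂, ·)` attains its minimum over
`[0, H]`. It exists and is unique when `P` is conjugate to some `R`, see `height_spec`. -/
noncomputable def height (P : E3 → ℝ) (H : ℝ) (x : E2) : ℝ :=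
  sInf {s | s ∈ Icc 0 H ∧ IsMinOn (columnEnergy P x) (Icc 0 H) s}

theorem horiz_lift (x : E2) (s : ℝ) : horiz (lift x s) = x := by
  ext i
  fin_cases i <;> simp [horiz, lift]

theorem inner_lift (x : E2) (s : ℝ) (y : E3) :
    inner ℝ (lift x s) y = x 0 * y 0 + x 1 * y 1 + s * y 2 := by
  simp [lift, PiLp.inner_apply, Fin.sum_univ_three, mul_comm]

/-- The heights `h_P^H` are well defined: the minimum of `Π_P(x₁, x₂, ·)` over `[0, H]` is attained
at `h_P^H(x₁, x₂)` and nowhere else. -/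
theorem height_spec {Ω : Set E2} {H D δ : ℝ} (hH : 0 ≤ H) (hδ : 0 < δ)
    {P R : E3 → ℝ}
    (hPR : ConvexConjugate (OmegaH Ω H) (Lam D δ) P R) {x : E2} (hx : x ∈ Ω) :
    height P H x ∈ Icc 0 H ∧
      ∀ s ∈ Icc 0 H, s ≠ height P H x → columnEnergy P x (height P H x) < columnEnergy P x s := by
  have hmem : ∀ s ∈ Icc (0 : ℝ) H, lift x s ∈ OmegaH Ω H := by
    intro s hs
    refine ⟨by rw [horiz_lift]; exact hx, ?_⟩
    simpa [lift] using hs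
  have hlow : ∀ s ∈ Icc (0 : ℝ) H, ∀ t ∈ Icc (0 : ℝ) H, s ≤ t →
      P (lift x t) ≤ P (lift x s) - δ * (t - s) := by
    intro s hs t ht hst
    refine (hPR.1 _ (hmem t ht)).2 ?_
    rintro _ ⟨y, hy, rfl⟩
    have h1 : inner ℝ (lift x s) y - R y ≤ P (lift x s) := (hPR.1 _ (hmem s hs)).1 ⟨y, hy, rfl⟩
    have h2 : y 2 ≤ -δ := hy.2.2
    simp only [inner_lift] at h1 ⊢
    nlinarith [mul_le_mul_of_nonneg_left h2 (sub_nonneg.2 hst)]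
  have hup : ∀ s ∈ Icc (0 : ℝ) H, ∀ t ∈ Icc (0 : ℝ) H, s ≤ t →
      P (lift x s) ≤ P (lift x t) + (1 / δ) * (t - s) := by
    intro s hs t ht hst
    refine (hPR.1 _ (hmem s hs)).2 ?_
    rintro _ ⟨y, hy, rfl⟩
    have h1 : inner ℝ (lift x t) y - R y ≤ P (lift x t) := (hPR.1 _ (hmem t ht)).1 ⟨y, hy, rfl⟩
    have h2 : -(1 / δ) ≤ y 2 := hy.2.1
    simp only [inner_lift] at h1 ⊢
    nlinarith [mul_le_mul_of_nonneg_left h2 (sub_nonneg.2 hst)]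
  set g : ℝ → ℝ := fun t => (1 / 2) * (x 0 ^ 2 + x 1 ^ 2) - P (lift x t) with hg
  have hmono : ∀ s ∈ Icc (0 : ℝ) H, ∀ t ∈ Icc (0 : ℝ) H, s < t → g s < g t := by
    intro s hs t ht hst
    have := hlow s hs t ht hst.le
    simp only [hg]
    nlinarith [mul_pos hδ (sub_pos.2 hst)]
  have hcont : ContinuousOn g (Icc 0 H) := by
    have hlip : LipschitzOnWith (Real.toNNReal (1 / δ)) g (Icc 0 H) := by
      refine LipschitzOnWith.of_le_add_mul _ ?_
      intro s hs t ht
      rw [Real.coe_toNNReal _ (by positivity), Real.dist_eq]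
      rcases le_total s t with hst | hst
      · have h1 := hlow s hs t ht hst
        have h2 : 0 ≤ (1 / δ) * |s - t| := by positivity
        simp only [hg]
        nlinarith [mul_nonneg hδ.le (sub_nonneg.2 hst)]
      · have h1 := hup t ht s hs hst
        rw [abs_of_nonneg (sub_nonneg.2 hst)]
        simp only [hg]
        linarith
    exact hlip.continuousOn
  have hint : ∀ a ∈ Icc (0 : ℝ) H, ∀ b ∈ Icc (0 : ℝ) H, IntervalIntegrable g volume a b := by
    intro a ha b hb
    exact (hcont.mono (uIcc_subset_Icc ha hb)).intervalIntegrable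
  have h0 : (0 : ℝ) ∈ Icc 0 H := ⟨le_rfl, hH⟩
  have hCE : ContinuousOn (columnEnergy P x) (Icc 0 H) := by
    have := intervalIntegral.continuousOn_primitive_interval (μ := volume) (f := g) (a := 0)
      (b := H) (by rw [uIcc_of_le hH]; exact hcont.integrableOn_Icc)
    rwa [uIcc_of_le hH] at this
  have hdiff : ∀ a ∈ Icc (0 : ℝ) H, ∀ b ∈ Icc (0 : ℝ) H,
      columnEnergy P x a + ∫ t in a..b, g t = columnEnergy P x b := fun a ha b hb =>
    intervalIntegral.integral_add_adjacent_intervals (hint 0 h0 a ha) (hint a ha b hb)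
  have huniq : ∀ a ∈ Icc (0 : ℝ) H, ∀ b ∈ Icc (0 : ℝ) H,
      IsMinOn (columnEnergy P x) (Icc 0 H) a → a < b →
      columnEnergy P x a < columnEnergy P x b := by
    intro a ha b hb hmin hab
    set m := (a + b) / 2 with hm
    have ham : a < m := by linarith
    have hmb : m < b := by linarith
    have hmI : m ∈ Icc (0 : ℝ) H := ⟨by linarith [ha.1], by linarith [hb.2]⟩
    have h1 := hdiff a ha m hmI
    have h2 := hdiff m hmI b hb
    have h3 : columnEnergy P x a ≤ columnEnergy P x m := hmin hmI
    have hgm : 0 ≤ g m := by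
      by_contra hneg
      have : 0 < ∫ t in a..m, -g t := by
        refine intervalIntegral.intervalIntegral_pos_of_pos_on (hint a ha m hmI).neg ?_ ham
        intro t ht
        have := hmono t ⟨by linarith [ha.1, ht.1], by linarith [ht.2, hmI.2]⟩ m hmI ht.2
        linarith
      rw [intervalIntegral.integral_neg] at this
      linarith
    have : 0 < ∫ t in m..b, g t := by
      refine intervalIntegral.intervalIntegral_pos_of_pos_on (hint m hmI b hb) ?_ hmb
      intro t ht
      have := hmono m hmI t ⟨by linarith [hmI.1, ht.1], by linarith [ht.2, hb.2]⟩ ht.1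
      linarith
    linarith
  obtain ⟨a, ha, hamin⟩ := isCompact_Icc.exists_isMinOn ⟨0, h0⟩ hCE
  have hset : {s | s ∈ Icc 0 H ∧ IsMinOn (columnEnergy P x) (Icc 0 H) s} = {a} := by
    refine Subset.antisymm ?_ (singleton_subset_iff.2 ⟨ha, hamin⟩)
    rintro s ⟨hs, hsmin⟩
    rcases lt_trichotomy s a with h | h | h
    · exact absurd (hamin hs) (not_le.2 (huniq s hs a ha hsmin h))
    · exact h
    · exact absurd (hsmin ha) (not_le.2 (huniq a ha s hs hamin h))
  have hha : height P H x = a := by rw [height, hset, csInf_singleton]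
  rw [hha]
  refine ⟨ha, fun s hs hsa => lt_of_le_of_ne (hamin hs) fun heq => hsa ?_⟩
  have : s ∈ ({a} : Set ℝ) := hset ▸ ⟨hs, fun t ht => heq ▸ hamin ht⟩
  exact this

end Geostrophic

/-!
Write `excess f x = ½(x₁² + x₂²) - f x`. For every `P` and `R` the cost splits as
`c(x, y) = excess P x + excess R y + (P x + R y - x · y)` (`cost_eq`), so the energy of a plan is a
dual value plus the integral of a nonnegative slack (`Admissible.integral_cost_eq`).

Since `y₃ ≤ -δ` on `Λ`, a conjugate potential `P` decreases in the vertical direction with slope at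
least `δ` (`IsSteep`). Hence `excess P` changes sign once on each vertical line, at a height
`root P` that is continuous in `x` and depends in a Lipschitz way on `P`. The subgraph of its
truncation `surface P H` to `[0, H]` consists of points where `excess P` is negative, and above the
surface, up to height `H`, `excess P` is nonnegative; so the subgraph minimizes `∫ excess P` by a
pointwise comparison of indicator functions (`IsSteep.indicator_surface_le`), uniquely among continuous heights
(`IsSteep.eqOn_surface`). If the surface encloses unit volume, its slope bound and the assumption on
`H` keep it strictly below `H` (`IsSteep.root_lt`); the truncation is then invisible, and the
minimality extends to heights that exceed `H`.

For weak duality (`dual_le_energy`), replace `P` by the conjugate of `R` and add the constant to it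
that makes the surface enclose unit volume, subtracting it from `R`; neither step decreases the
dual value.

At a maximizer, varying `R` in the direction of a bounded continuous `φ` changes the conjugate
potential by `-ε φ(∇P) + o(ε)` at every point of differentiability (`tendsto_legendre_variation`),
hence almost everywhere by Rademacher's theorem, and the accompanying motion of the surface
contributes only at second order. The resulting Euler-Lagrange equation is `∇P♯σ = ν`
(`map_gradient_eq`); in particular the surface encloses unit volume. So the graph of `∇P` over the
fluid region is admissible, and as it consists of contact points, where the slack vanishes, it
attains the dual value (`admissible_graph`). Conversely equality forces the height to be the surface
and the plan to live on contact points, where `y = ∇P(x)` (`Admissible.eq_graph`). By symmetry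
`x = ∇R(y)` at contact points where `R` is differentiable, which is the inversion formula
(`map_gradient_right`).
-/

open MeasureTheory Set

namespace Geostrophic

/-! ### Coordinates -/

theorem lift_horiz (x : E3) : lift (horiz x) (x 2) = x := by
  ext i
  fin_cases i <;> simp [horiz, lift]

theorem lift_two (x : E2) (s : ℝ) : lift x s 2 = s := rfl

theorem continuous_horiz : Continuous horiz := by
  unfold horiz
  fun_prop

theorem continuous_lift : Continuous fun p : E2 × ℝ => lift p.1 p.2 := by
  unfold lift
  fun_prop

theorem continuous_lift_left (t : ℝ) : Continuous fun x : E2 => lift x t :=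
  continuous_lift.comp (by fun_prop : Continuous fun x : E2 => (x, t))

theorem continuous_lift_right (x : E2) : Continuous fun t : ℝ => lift x t :=
  continuous_lift.comp (by fun_prop : Continuous fun t : ℝ => (x, t))

theorem norm_horiz_le (y : E3) : ‖horiz y‖ ≤ |y 0| + |y 1| := by
  rw [EuclideanSpace.norm_eq, Real.sqrt_le_left (by positivity)]
  simp only [Fin.sum_univ_two, horiz, Real.norm_eq_abs]
  simp
  nlinarith [abs_nonneg (y 0), abs_nonneg (y 1), sq_abs (y 0), sq_abs (y 1),
    mul_nonneg (abs_nonneg (y 0)) (abs_nonneg (y 1))]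

theorem inner_lift_sub (x x' : E2) (s : ℝ) (y : E3) :
    inner ℝ (lift x s - lift x' s) y = inner ℝ (x - x') (horiz y) := by
  rw [inner_sub_left, inner_lift, inner_lift]
  simp [PiLp.inner_apply, Fin.sum_univ_two, horiz]
  ring

/-- Splitting off the last coordinate preserves Lebesgue measure. -/
theorem measurePreserving_horiz_vert :
    MeasurePreserving (fun x : E3 => (horiz x, x 2)) volume volume := by
  have h1 : MeasurePreserving (fun x : E3 => (WithLp.ofLp x : Fin 3 → ℝ)) volume volume :=
    PiLp.volume_preserving_ofLp (Fin 3)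
  have h2 := volume_preserving_piFinSuccAbove (fun _ : Fin 3 => ℝ) 2
  have h3 : MeasurePreserving (fun x : Fin 2 → ℝ => (WithLp.toLp 2 x : E2)) volume volume :=
    PiLp.volume_preserving_toLp (Fin 2)
  have h4 : MeasurePreserving (Prod.map (fun x : Fin 2 → ℝ => (WithLp.toLp 2 x : E2)) (id : ℝ → ℝ))
      volume volume := h3.prod (MeasurePreserving.id _)
  have h5 : MeasurePreserving (Prod.swap : ℝ × (Fin 2 → ℝ) → (Fin 2 → ℝ) × ℝ) volume volume :=
    Measure.measurePreserving_swap
  have h := h4.comp (h5.comp (h2.comp h1))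
  convert h using 1
  funext x
  simp only [Function.comp, Prod.map]
  refine Prod.ext ?_ ?_
  · ext i
    fin_cases i <;> rfl
  · rfl

theorem isBounded_OmegaH {Ω : Set E2} (hΩ : Bornology.IsBounded Ω) (H : ℝ) :
    Bornology.IsBounded (OmegaH Ω H) := by
  have h : Bornology.IsBounded ((fun p : E2 × ℝ => lift p.1 p.2) '' (closure Ω ×ˢ Icc 0 H)) :=
    ((hΩ.isCompact_closure.prod isCompact_Icc).image continuous_lift).isBounded
  refine h.subset fun x hx => ⟨(horiz x, x 2), ⟨subset_closure hx.1, hx.2⟩, lift_horiz x⟩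

theorem isClosed_cylinder {A : Set E2} {I : Set ℝ} (hA : IsClosed A) (hI : IsClosed I) :
    IsClosed (cylinder A I) :=
  (hA.preimage continuous_horiz).inter
    (hI.preimage (by fun_prop : Continuous fun x : E3 => x 2))

theorem isCompact_Lam (D δ : ℝ) : IsCompact (Lam D δ) := by
  have h : IsCompact ((fun p : E2 × ℝ => lift p.1 p.2) ''
      (Metric.closedBall (0 : E2) D ×ˢ Icc (-(1 / δ)) (-δ))) :=
    ((isCompact_closedBall _ _).prod isCompact_Icc).image continuous_lift
  refine h.of_isClosed_subset (isClosed_cylinder Metric.isClosed_closedBall isClosed_Icc) ?_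
  exact fun x hx => ⟨(horiz x, x 2), hx, lift_horiz x⟩

theorem convex_Lam (D δ : ℝ) : Convex ℝ (Lam D δ) := by
  intro x hx y hy a b ha hb hab
  have hz : horiz (a • x + b • y) = a • horiz x + b • horiz y := by
    ext i
    fin_cases i <;> simp [horiz]
  refine ⟨?_, ?_⟩
  · rw [hz]
    exact convex_closedBall _ _ hx.1 hy.1 ha hb hab
  · simpa using convex_Icc _ _ hx.2 hy.2 ha hb hab

/-! ### Subgraphs and their volume -/

theorem subgraph_congr {Ω : Set E2} {h h' : E2 → ℝ} (hh : EqOn h h' Ω) :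
    subgraph Ω h = subgraph Ω h' := by
  ext x
  simp only [subgraph, mem_ofPred_eq]
  exact and_congr_right fun hx => by rw [hh hx]

theorem sigma_congr {Ω : Set E2} {h h' : E2 → ℝ} (hh : EqOn h h' Ω) :
    sigma Ω h = sigma Ω h' := by
  rw [sigma, sigma, subgraph_congr hh]

theorem measurableSet_subgraph {Ω : Set E2} (hΩ : MeasurableSet Ω) {h : E2 → ℝ}
    (hh : Measurable h) : MeasurableSet (subgraph Ω h) := by
  have h0 : Measurable fun x : E3 => x 2 := by fun_prop
  exact (continuous_horiz.measurable hΩ).inter ((measurableSet_lt measurable_const h0).inter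
    (measurableSet_lt h0 (hh.comp continuous_horiz.measurable)))

theorem isOpen_subgraph {Ω : Set E2} (hΩ : IsOpen Ω) {h : E2 → ℝ} (hh : ContinuousOn h Ω) :
    IsOpen (subgraph Ω h) := by
  have h0 : Continuous fun x : E3 => x 2 := by fun_prop
  have h1 : IsOpen (horiz ⁻¹' Ω) := hΩ.preimage continuous_horiz
  have h2 : ContinuousOn (fun x : E3 => h (horiz x) - x 2) (horiz ⁻¹' Ω) :=
    (hh.comp continuous_horiz.continuousOn fun x hx => hx).sub h0.continuousOn
  have h3 := (h2.isOpen_inter_preimage h1 (isOpen_Ioi (a := (0 : ℝ)))).inter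
    (isOpen_lt (continuous_const (y := (0 : ℝ))) h0)
  convert h3 using 1
  ext x
  simp only [subgraph, mem_ofPred_eq, mem_inter_iff, mem_preimage, mem_Ioi, sub_pos]
  tauto

theorem volume_subgraph {Ω : Set E2} (hΩ : MeasurableSet Ω) {h : E2 → ℝ}
    (hh : IntegrableOn h Ω) (h0 : ∀ x ∈ Ω, 0 ≤ h x) (hm : MeasurableSet (subgraph Ω h)) :
    volume (subgraph Ω h) = ENNReal.ofReal (∫ x in Ω, h x) := by
  have h1 := volume_regionBetween_eq_integral (μ := (volume : Measure E2)) (f := fun _ => (0 : ℝ))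
    (g := h) (integrable_zero _ _ _) hh hΩ h0
  simp only [Pi.sub_apply, sub_zero] at h1
  have h2 : (fun x : E3 => (horiz x, x 2)) ⁻¹' (regionBetween (fun _ => (0 : ℝ)) h Ω)
      = subgraph Ω h := rfl
  have hr : MeasurableSet (regionBetween (fun _ => (0 : ℝ)) h Ω) := by
    convert continuous_lift.measurable hm using 1
    ext p
    simp [regionBetween, subgraph, horiz_lift, lift_two]
  rw [← h2, measurePreserving_horiz_vert.measure_preimage hr.nullMeasurableSet, ← h1]
  rfl

theorem sigma_real_univ {Ω : Set E2} (hΩ : MeasurableSet Ω) {h : E2 → ℝ}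
    (hh : IntegrableOn h Ω) (h0 : ∀ x ∈ Ω, 0 ≤ h x) (hm : MeasurableSet (subgraph Ω h)) :
    (sigma Ω h).real univ = ∫ x in Ω, h x := by
  rw [sigma, measureReal_def, Measure.restrict_apply_univ, volume_subgraph hΩ hh h0 hm,
    ENNReal.toReal_ofReal (setIntegral_nonneg hΩ h0)]

/-! ### Convex conjugates over a bounded set -/

/-- The convex conjugate `x ↦ sup_{y ∈ B} (x · y - g y)` of `g` on `B`, defined on the whole
space. -/
noncomputable def legendre (B : Set E3) (g : E3 → ℝ) (x : E3) : ℝ :=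
  sSup ((fun y => inner ℝ x y - g y) '' B)

theorem bddAbove_legendre {B : Set E3} {g : E3 → ℝ} (hB : Bornology.IsBounded B) {c : ℝ}
    (hc : ∀ y ∈ B, c ≤ g y) (x : E3) : BddAbove ((fun y => inner ℝ x y - g y) '' B) := by
  obtain ⟨K, hK⟩ := hB.exists_norm_le
  refine ⟨‖x‖ * K - c, ?_⟩
  rintro _ ⟨y, hy, rfl⟩
  have h1 := real_inner_le_norm x y
  have h2 := mul_le_mul_of_nonneg_left (hK y hy) (norm_nonneg x)
  have h3 := hc y hy
  simp only
  linarith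

theorem le_legendre {B : Set E3} {g : E3 → ℝ} (hB : Bornology.IsBounded B) {c : ℝ}
    (hc : ∀ y ∈ B, c ≤ g y) (x : E3) {y : E3} (hy : y ∈ B) :
    inner ℝ x y - g y ≤ legendre B g x :=
  le_csSup (bddAbove_legendre hB hc x) ⟨y, hy, rfl⟩

theorem legendre_le {B : Set E3} {g : E3 → ℝ} (hne : B.Nonempty) {x : E3} {a : ℝ}
    (h : ∀ y ∈ B, inner ℝ x y - g y ≤ a) : legendre B g x ≤ a := by
  refine csSup_le (hne.image _) ?_
  rintro _ ⟨y, hy, rfl⟩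
  exact h y hy

theorem legendre_le_add {B : Set E3} {g : E3 → ℝ} (hB : Bornology.IsBounded B)
    (hne : B.Nonempty) {c : ℝ} (hc : ∀ y ∈ B, c ≤ g y) {x x' : E3} {a : ℝ}
    (h : ∀ y ∈ B, inner ℝ (x - x') y ≤ a) : legendre B g x ≤ legendre B g x' + a := by
  refine legendre_le hne fun y hy => ?_
  have h1 := le_legendre hB hc x' hy
  have h2 := h y hy
  rw [inner_sub_left] at h2
  linarith

theorem exists_lipschitzWith_legendre {B : Set E3} {g : E3 → ℝ} (hB : Bornology.IsBounded B)
    (hne : B.Nonempty) {c : ℝ} (hc : ∀ y ∈ B, c ≤ g y) :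
    ∃ K, LipschitzWith K (legendre B g) := by
  obtain ⟨K, hK⟩ := hB.exists_norm_le
  refine ⟨K.toNNReal, LipschitzWith.of_le_add_mul _ fun x x' => ?_⟩
  refine legendre_le_add hB hne hc fun y hy => (real_inner_le_norm _ _).trans ?_
  rw [dist_eq_norm, mul_comm]
  exact mul_le_mul_of_nonneg_right ((hK y hy).trans (Real.le_coe_toNNReal K)) (norm_nonneg _)

/-! ### Steep potentials and their free surface -/

/-- The potentials for which the free surface is well behaved: Lipschitz functions on `ℝ³` that
decrease with slope at least `δ` in the vertical direction and have Lipschitz constant `b` in the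
horizontal directions. -/
structure IsSteep (δ b : ℝ) (P : E3 → ℝ) : Prop where
  lipschitz : ∃ K, LipschitzWith K P
  vertical : ∀ x s t, s ≤ t → P (lift x t) ≤ P (lift x s) - δ * (t - s)
  horizontal : ∀ x x' t, P (lift x t) ≤ P (lift x' t) + b * ‖x - x'‖

theorem IsSteep.legendre_Lam {D δ b : ℝ} (hne : (Lam D δ).Nonempty)
    (hb : ∀ y ∈ Lam D δ, ‖horiz y‖ ≤ b) {R : E3 → ℝ} {c : ℝ} (hc : ∀ y ∈ Lam D δ, c ≤ R y) :
    IsSteep δ b (legendre (Lam D δ) R) where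
  lipschitz := exists_lipschitzWith_legendre (isCompact_Lam D δ).isBounded hne hc
  vertical x s t hst := by
    refine legendre_le_add (isCompact_Lam D δ).isBounded hne hc (a := -(δ * (t - s)))
      fun y hy => ?_
    rw [inner_sub_left, inner_lift, inner_lift]
    have h2 : y 2 ≤ -δ := hy.2.2
    nlinarith [mul_le_mul_of_nonneg_left h2 (sub_nonneg.2 hst)]
  horizontal x x' t := by
    refine legendre_le_add (isCompact_Lam D δ).isBounded hne hc fun y hy => ?_
    rw [inner_lift_sub, mul_comm]
    exact (real_inner_le_norm _ _).trans
      (mul_le_mul_of_nonneg_left (hb y hy) (norm_nonneg _))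

theorem IsSteep.add_const {δ b : ℝ} {P : E3 → ℝ} (hP : IsSteep δ b P) (k : ℝ) :
    IsSteep δ b fun x => P x + k where
  lipschitz := by
    obtain ⟨K, hK⟩ := hP.lipschitz
    exact ⟨K, LipschitzWith.of_le_add_mul _ fun x y => by linarith [hK.le_add_mul x y]⟩
  vertical x s t hst := by linarith [hP.vertical x s t hst]
  horizontal x x' t := by linarith [hP.horizontal x x' t]

/-- The energy density `½(x₁² + x₂²) - P(x)` that is integrated over the fluid domain. -/
noncomputable def excess (P : E3 → ℝ) (x : E3) : ℝ := (1 / 2) * (x 0 ^ 2 + x 1 ^ 2) - P x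

theorem excess_lift (P : E3 → ℝ) (x : E2) (t : ℝ) :
    excess P (lift x t) = (1 / 2) * (x 0 ^ 2 + x 1 ^ 2) - P (lift x t) := rfl

theorem IsSteep.continuous {δ b : ℝ} {P : E3 → ℝ} (hP : IsSteep δ b P) : Continuous P :=
  hP.lipschitz.choose_spec.continuous

theorem IsSteep.continuous_excess {δ b : ℝ} {P : E3 → ℝ} (hP : IsSteep δ b P) :
    Continuous (excess P) := by
  have := hP.continuous
  unfold excess
  fun_prop

theorem IsSteep.excess_add_le {δ b : ℝ} {P : E3 → ℝ} (hP : IsSteep δ b P) (x : E2) {s t : ℝ}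
    (hst : s ≤ t) : excess P (lift x s) + δ * (t - s) ≤ excess P (lift x t) := by
  rw [excess_lift, excess_lift]
  linarith [hP.vertical x s t hst]

theorem IsSteep.strictMono_excess {δ b : ℝ} (hδ : 0 < δ) {P : E3 → ℝ} (hP : IsSteep δ b P)
    (x : E2) : StrictMono fun t => excess P (lift x t) := fun s t hst => by
  have := hP.excess_add_le x hst.le
  have := mul_pos hδ (sub_pos.2 hst)
  simp only
  linarith

theorem IsSteep.exists_excess_eq_zero {δ b : ℝ} (hδ : 0 < δ) {P : E3 → ℝ} (hP : IsSteep δ b P)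
    (x : E2) : ∃ t, excess P (lift x t) = 0 := by
  set v := excess P (lift x 0) with hv
  have h0 : 0 ≤ |v| / δ := by positivity
  have hm : δ * (|v| / δ) = |v| := by field_simp
  have h1 := hP.excess_add_le x (neg_nonpos.2 h0)
  have h2 := hP.excess_add_le x h0
  have hc : Continuous fun t => excess P (lift x t) :=
    hP.continuous_excess.comp (continuous_lift_right x)
  have := intermediate_value_Icc (neg_le_self h0) hc.continuousOn
  obtain ⟨t, -, ht⟩ := this (show (0 : ℝ) ∈ Icc _ _ from
    ⟨by linarith [le_abs_self v], by linarith [neg_abs_le v]⟩)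
  exact ⟨t, ht⟩

/-- The height at which the energy density over `x` vanishes, for a steep potential: the free
surface in the absence of the constraints `0 ≤ h ≤ H`. -/
noncomputable def root (P : E3 → ℝ) (x : E2) : ℝ :=
  Classical.epsilon fun t => excess P (lift x t) = 0

theorem IsSteep.excess_root {δ b : ℝ} (hδ : 0 < δ) {P : E3 → ℝ} (hP : IsSteep δ b P) (x : E2) :
    excess P (lift x (root P x)) = 0 :=
  Classical.epsilon_spec (hP.exists_excess_eq_zero hδ x)

theorem IsSteep.excess_neg_iff {δ b : ℝ} (hδ : 0 < δ) {P : E3 → ℝ} (hP : IsSteep δ b P) {x : E2}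
    {t : ℝ} : excess P (lift x t) < 0 ↔ t < root P x := by
  rw [← hP.excess_root hδ x]
  exact (hP.strictMono_excess hδ x).lt_iff_lt

theorem IsSteep.excess_pos_iff {δ b : ℝ} (hδ : 0 < δ) {P : E3 → ℝ} (hP : IsSteep δ b P) {x : E2}
    {t : ℝ} : 0 < excess P (lift x t) ↔ root P x < t := by
  conv_lhs => rw [← hP.excess_root hδ x]
  exact (hP.strictMono_excess hδ x).lt_iff_lt

theorem IsSteep.continuous_root {δ b : ℝ} (hδ : 0 < δ) {P : E3 → ℝ} (hP : IsSteep δ b P) :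
    Continuous (root P) := by
  have hc (t : ℝ) : Continuous fun x => excess P (lift x t) :=
    hP.continuous_excess.comp (continuous_lift_left t)
  rw [continuous_iff_lower_upperSemicontinuous, lowerSemicontinuous_iff_isOpen_preimage,
    upperSemicontinuous_iff_isOpen_preimage]
  refine ⟨fun t => ?_, fun t => ?_⟩
  · convert isOpen_lt (hc t) continuous_const using 1
    ext x
    exact (hP.excess_neg_iff hδ).symm
  · convert isOpen_lt continuous_const (hc t) using 1
    ext x
    exact (hP.excess_pos_iff hδ).symm

theorem IsSteep.root_le_root_add {δ b : ℝ} (hδ : 0 < δ) {P P' : E3 → ℝ} (hP : IsSteep δ b P)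
    (hP' : IsSteep δ b P') {x x' : E2} {η : ℝ} (hη : 0 ≤ η)
    (h : ∀ t, excess P (lift x t) ≤ excess P' (lift x' t) + η) :
    root P' x' ≤ root P x + η / δ := by
  rcases le_total (root P' x') (root P x) with hr | hr
  · have : 0 ≤ η / δ := by positivity
    linarith
  · have h1 := hP.excess_add_le x hr
    have h2 := h (root P' x')
    rw [hP'.excess_root hδ] at h2
    rw [hP.excess_root hδ] at h1
    rw [← sub_le_iff_le_add', le_div_iff₀ hδ]
    linarith

/-- The free surface with the constraints `0 ≤ h ≤ H`. -/
noncomputable def surface (P : E3 → ℝ) (H : ℝ) (x : E2) : ℝ := max 0 (min H (root P x))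

theorem surface_nonneg (P : E3 → ℝ) (H : ℝ) (x : E2) : 0 ≤ surface P H x := le_max_left _ _

theorem surface_le (P : E3 → ℝ) {H : ℝ} (hH : 0 ≤ H) (x : E2) : surface P H x ≤ H :=
  max_le hH (min_le_left _ _)

theorem IsSteep.continuous_surface {δ b : ℝ} (hδ : 0 < δ) {P : E3 → ℝ} (hP : IsSteep δ b P)
    (H : ℝ) : Continuous (surface P H) :=
  continuous_const.max (continuous_const.min (hP.continuous_root hδ))

theorem surface_le_surface_add {P P' : E3 → ℝ} {H : ℝ} {x x' : E2} {η : ℝ} (hη : 0 ≤ η)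
    (h : root P' x' ≤ root P x + η) : surface P' H x' ≤ surface P H x + η := by
  refine max_le (add_nonneg (surface_nonneg _ _ _) hη) ?_
  rcases le_total H (root P x) with h1 | h1
  · have : H ≤ surface P H x := by rw [surface, min_eq_left h1]; exact le_max_right _ _
    exact (min_le_left _ _).trans (by linarith)
  · have : root P x ≤ surface P H x := by rw [surface, min_eq_right h1]; exact le_max_right _ _
    exact (min_le_right _ _).trans (by linarith)

theorem IsSteep.abs_surface_sub_le {δ b : ℝ} (hδ : 0 < δ) {P P' : E3 → ℝ} (hP : IsSteep δ b P)
    (hP' : IsSteep δ b P') (H : ℝ) {η : ℝ} (h : ∀ x, |P x - P' x| ≤ η) (x : E2) :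
    |surface P H x - surface P' H x| ≤ η / δ := by
  have hη : 0 ≤ η := (abs_nonneg _).trans (h 0)
  have hη' : 0 ≤ η / δ := by positivity
  have h1 := surface_le_surface_add (H := H) hη' (hP.root_le_root_add hδ hP' (x := x) (x' := x) hη
    fun t => by rw [excess_lift, excess_lift]; linarith [neg_le_of_abs_le (h (lift x t))])
  have h2 := surface_le_surface_add (H := H) hη' (hP'.root_le_root_add hδ hP (x := x) (x' := x) hη
    fun t => by rw [excess_lift, excess_lift]; linarith [le_of_abs_le (h (lift x t))])
  rw [abs_le]
  constructor <;> linarith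

/-- Over a set bounded by `M`, the slope of the free surface is at most `(M + b) / δ`. -/
theorem IsSteep.surface_le_add {δ b M : ℝ} (hδ : 0 < δ) (hb : 0 ≤ b) {P : E3 → ℝ}
    (hP : IsSteep δ b P) (H : ℝ) {x x' : E2} (hx : ‖x‖ ≤ M) (hx' : ‖x'‖ ≤ M) :
    surface P H x' ≤ surface P H x + (M + b) / δ * ‖x - x'‖ := by
  have hM : 0 ≤ M := (norm_nonneg x).trans hx
  have hη : 0 ≤ (M + b) * ‖x - x'‖ := by positivity
  rw [div_mul_eq_mul_div]
  refine surface_le_surface_add (by positivity) (hP.root_le_root_add hδ hP hη fun t => ?_)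
  rw [excess_lift, excess_lift]
  have h1 := hP.horizontal x' x t
  rw [norm_sub_rev] at h1
  have h2 : ∀ z : E2, z 0 ^ 2 + z 1 ^ 2 = ‖z‖ ^ 2 := fun z => by
    rw [EuclideanSpace.norm_sq_eq, Fin.sum_univ_two]
    simp
  have h3 := norm_sub_norm_le x x'
  rw [h2, h2]
  nlinarith [norm_nonneg x, norm_nonneg x', norm_nonneg (x - x')]

/-- The height of the free surface, defined by minimizing the column energy, is `surface`. -/
theorem height_eq_surface {Ω : Set E2} {H D δ b : ℝ} (hH : 0 ≤ H) (hδ : 0 < δ) {P P' R : E3 → ℝ}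
    (hPR : ConvexConjugate (OmegaH Ω H) (Lam D δ) P R) (hP' : IsSteep δ b P')
    (heq : EqOn P P' (OmegaH Ω H)) : EqOn (height P H) (surface P' H) Ω := by
  intro x hx
  obtain ⟨h1, h2⟩ := height_spec hH hδ hPR hx
  by_contra hne
  have h3 := h2 (surface P' H x) ⟨surface_nonneg _ _ _, surface_le _ hH _⟩ (Ne.symm hne)
  refine absurd h3 (not_lt.2 ?_)
  set g := fun t => excess P' (lift x t) with hg
  have hgc : Continuous g := hP'.continuous_excess.comp (continuous_lift_right x)
  have hcol : ∀ s ∈ Icc 0 H, columnEnergy P x s = ∫ t in (0 : ℝ)..s, g t := by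
    intro s hs
    refine intervalIntegral.integral_congr fun t ht => ?_
    rw [uIcc_of_le hs.1] at ht
    have hm : lift x t ∈ OmegaH Ω H := ⟨by rwa [horiz_lift], ht.1, ht.2.trans hs.2⟩
    simp only [hg, excess_lift, heq hm]
  rw [hcol _ h1, hcol _ ⟨surface_nonneg _ _ _, surface_le _ hH _⟩]
  have hi (a c : ℝ) : IntervalIntegrable g volume a c := hgc.intervalIntegrable _ _
  rw [← sub_nonneg, intervalIntegral.integral_interval_sub_left (hi _ _) (hi _ _)]
  set s := height P H x
  set u := surface P' H x with hu
  rcases le_total u s with hus | hus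
  · refine intervalIntegral.integral_nonneg hus fun t ht => ?_
    by_contra hneg
    have h4 := (hP'.excess_neg_iff hδ).1 (not_le.1 hneg)
    -- `u < s ≤ H` rules out `H ≤ u`, hence `root ≤ u ≤ t`
    have h5 : min H (root P' x) ≤ u := le_max_right _ _
    rcases min_le_iff.1 h5 with h6 | h6
    · exact hne (le_antisymm (h1.2.trans h6) hus)
    · linarith [ht.1]
  · rw [intervalIntegral.integral_symm, ← intervalIntegral.integral_neg]
    refine intervalIntegral.integral_nonneg hus fun t ht => ?_
    rw [neg_nonneg]
    by_contra hpos
    have h4 := (hP'.excess_pos_iff hδ).1 (not_le.1 hpos)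
    have h5 : u ≤ max 0 (root P' x) := max_le_max le_rfl (min_le_right _ _)
    rcases le_max_iff.1 h5 with h6 | h6
    · exact hne (le_antisymm hus (h6.trans h1.1))
    · linarith [ht.2]

/-! ### Extended integrals -/

section ExtIntegral

variable {X : Type*} [MeasurableSpace X] {μ : Measure X} {f g : X → ℝ}

theorem extIntegral_eq_integral (hf : Integrable f μ) :
    extIntegral μ f = ((∫ x, f x ∂μ : ℝ) : EReal) := by
  have h1 : (∫⁻ x, ENNReal.ofReal (f x) ∂μ) ≠ ⊤ := hf.lintegral_lt_top.ne
  have h2 : (∫⁻ x, ENNReal.ofReal (-f x) ∂μ) ≠ ⊤ := hf.neg.lintegral_lt_top.ne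
  rw [extIntegral, integral_eq_lintegral_pos_part_sub_lintegral_neg_part hf, EReal.coe_sub,
    EReal.coe_ennreal_toReal h1, EReal.coe_ennreal_toReal h2]

theorem extIntegral_mono_ae (h : f ≤ᵐ[μ] g) : extIntegral μ f ≤ extIntegral μ g := by
  refine EReal.sub_le_sub ?_ ?_
  · exact EReal.coe_ennreal_le_coe_ennreal_iff.2
      (lintegral_mono_ae (h.mono fun x hx => ENNReal.ofReal_le_ofReal hx))
  · exact EReal.coe_ennreal_le_coe_ennreal_iff.2
      (lintegral_mono_ae (h.mono fun x hx => ENNReal.ofReal_le_ofReal (neg_le_neg hx)))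

theorem extIntegral_congr_ae (h : f =ᵐ[μ] g) : extIntegral μ f = extIntegral μ g :=
  le_antisymm (extIntegral_mono_ae h.le) (extIntegral_mono_ae h.symm.le)

theorem lintegral_ofReal_eq_top (hf : AEMeasurable f μ) (h1 : ¬ Integrable f μ)
    (h2 : ∫⁻ x, ENNReal.ofReal (-f x) ∂μ ≠ ⊤) : ∫⁻ x, ENNReal.ofReal (f x) ∂μ = ⊤ := by
  by_contra h3
  refine h1 ⟨hf.aestronglyMeasurable, ?_⟩
  rw [hasFiniteIntegral_iff_norm]
  refine lt_of_le_of_lt (lintegral_mono fun x => ?_)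
    ((lintegral_add_left' hf.ennreal_ofReal _).trans_lt
      (ENNReal.add_lt_top.2 ⟨lt_top_iff_ne_top.2 h3, lt_top_iff_ne_top.2 h2⟩))
  rw [Real.norm_eq_abs]
  rcases abs_cases (f x) with ⟨h, -⟩ | ⟨h, -⟩ <;> rw [h]
  · exact le_self_add
  · exact le_add_self

theorem extIntegral_eq_bot [IsFiniteMeasure μ] (hf : AEMeasurable f μ) {C : ℝ}
    (hC : ∀ᵐ x ∂μ, f x ≤ C) (h : ¬ Integrable f μ) : extIntegral μ f = ⊥ := by
  have h1 : ∫⁻ x, ENNReal.ofReal (f x) ∂μ ≠ ⊤ :=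
    ((lintegral_mono_ae (hC.mono fun x hx => ENNReal.ofReal_le_ofReal hx)).trans_lt
      (by rw [lintegral_const]; exact ENNReal.mul_lt_top ENNReal.ofReal_lt_top
            (measure_lt_top _ _))).ne
  have h2 : ∫⁻ x, ENNReal.ofReal (-f x) ∂μ = ⊤ :=
    lintegral_ofReal_eq_top hf.neg (fun h' => h (by simpa using h'.neg)) (by simpa using h1)
  rw [extIntegral, h2]
  simp

theorem extIntegral_eq_top (hf : AEMeasurable f μ) (h0 : ∀ᵐ x ∂μ, 0 ≤ f x)
    (h : ¬ Integrable f μ) : extIntegral μ f = ⊤ := by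
  have h1 : ∫⁻ x, ENNReal.ofReal (-f x) ∂μ = 0 :=
    lintegral_eq_zero_of_ae_eq_zero (h0.mono fun x hx => by simpa using hx)
  have h2 := lintegral_ofReal_eq_top hf h (by simp [h1])
  rw [extIntegral, h1, h2]
  simp

end ExtIntegral

/-! ### Optimality of the free surface -/

theorem root_le_of_surface_le {P : E3 → ℝ} {H : ℝ} {x : E2} {t a : ℝ}
    (ha : a ≤ H ∨ root P x < H) (ht : surface P H x ≤ t) (hta : t < a) : root P x ≤ t := by
  have h1 : min H (root P x) ≤ t := (le_max_right _ _).trans ht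
  rcases min_le_iff.1 h1 with h2 | h2
  · rcases ha with h3 | h3 <;> linarith
  · exact h2

theorem lt_root_of_lt_surface {P : E3 → ℝ} {H : ℝ} {x : E2} {t : ℝ} (h0 : 0 < t)
    (ht : t < surface P H x) : t < root P x := by
  rcases lt_max_iff.1 ht with h1 | h1
  · linarith
  · exact (lt_min_iff.1 h1).2

/-- The energy density is negative below the free surface and nonnegative above it. -/
theorem IsSteep.indicator_surface_le {δ b : ℝ} (hδ : 0 < δ) {P : E3 → ℝ} (hP : IsSteep δ b P)
    {Ω : Set E2} {H : ℝ} {h : E2 → ℝ} (hh : ∀ x ∈ Ω, h x ≤ H ∨ root P x < H) (x : E3) :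
    (subgraph Ω (surface P H)).indicator (excess P) x ≤ (subgraph Ω h).indicator (excess P) x := by
  have hx := lift_horiz x
  by_cases h1 : x ∈ subgraph Ω (surface P H) <;> by_cases h2 : x ∈ subgraph Ω h
  · simp [h1, h2]
  · rw [indicator_of_mem h1, indicator_of_notMem h2]
    have := (hP.excess_neg_iff hδ).2 (lt_root_of_lt_surface h1.2.1 h1.2.2)
    rw [hx] at this
    exact this.le
  · rw [indicator_of_notMem h1, indicator_of_mem h2]
    have h3 : surface P H (horiz x) ≤ x 2 := not_lt.1 fun h => h1 ⟨h2.1, h2.2.1, h⟩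
    have h4 := root_le_of_surface_le (hh _ h2.1) h3 h2.2.2
    have h5 := mt (hP.excess_neg_iff hδ (x := horiz x)).1 (not_lt.2 h4)
    rw [hx] at h5
    exact not_lt.1 h5
  · simp [h1, h2]

theorem subgraph_subset_OmegaH {Ω : Set E2} {h : E2 → ℝ} {H : ℝ} (hh : ∀ x ∈ Ω, h x ≤ H) :
    subgraph Ω h ⊆ OmegaH Ω H := fun _ hx => ⟨hx.1, hx.2.1.le, hx.2.2.le.trans (hh _ hx.1)⟩

theorem integrable_sigma {Ω : Set E2} (hΩ : Bornology.IsBounded Ω) {h : E2 → ℝ} {H : ℝ}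
    (hh : ∀ x ∈ Ω, h x ≤ H) {f : E3 → ℝ} (hf : Continuous f) : Integrable f (sigma Ω h) := by
  have h1 : IntegrableOn f (closure (OmegaH Ω H)) :=
    hf.continuousOn.integrableOn_compact (isBounded_OmegaH hΩ H).isCompact_closure
  exact h1.mono_set ((subgraph_subset_OmegaH hh).trans subset_closure)

theorem IsSteep.integral_surface_le {δ b : ℝ} (hδ : 0 < δ) {P : E3 → ℝ} (hP : IsSteep δ b P)
    {Ω : Set E2} (hΩ : Bornology.IsBounded Ω) (hΩm : MeasurableSet Ω) {H : ℝ} (hH : 0 ≤ H)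
    {h : E2 → ℝ} (hh : ∀ x ∈ Ω, h x ≤ H ∨ root P x < H) (hm : MeasurableSet (subgraph Ω h))
    (hi : Integrable (excess P) (sigma Ω h)) :
    ∫ x, excess P x ∂sigma Ω (surface P H) ≤ ∫ x, excess P x ∂sigma Ω h := by
  have hm' := measurableSet_subgraph hΩm (hP.continuous_surface hδ H).measurable
  have hi' : Integrable (excess P) (sigma Ω (surface P H)) :=
    integrable_sigma hΩ (fun x _ => surface_le P hH x) hP.continuous_excess
  rw [sigma, sigma, ← integral_indicator hm, ← integral_indicator hm']
  exact integral_mono ((integrable_indicator_iff hm').2 hi') ((integrable_indicator_iff hm).2 hi)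
    (hP.indicator_surface_le hδ hh)

theorem isOpen_supergraph {Ω : Set E2} (hΩ : IsOpen Ω) {h : E2 → ℝ} (hh : ContinuousOn h Ω) :
    IsOpen {x : E3 | horiz x ∈ Ω ∧ h (horiz x) < x 2} := by
  have h0 : Continuous fun x : E3 => x 2 := by fun_prop
  have h1 : IsOpen (horiz ⁻¹' Ω) := hΩ.preimage continuous_horiz
  have h2 : ContinuousOn (fun x : E3 => x 2 - h (horiz x)) (horiz ⁻¹' Ω) :=
    h0.continuousOn.sub (hh.comp continuous_horiz.continuousOn fun x hx => hx)
  convert h2.isOpen_inter_preimage h1 (isOpen_Ioi (a := (0 : ℝ))) using 1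
  ext x
  simp

/-- Among continuous heights, only the free surface is optimal. -/
theorem IsSteep.eqOn_surface {δ b : ℝ} (hδ : 0 < δ) {P : E3 → ℝ} (hP : IsSteep δ b P)
    {Ω : Set E2} (hΩ : Bornology.IsBounded Ω) (hΩo : IsOpen Ω) {H : ℝ} (hH : 0 ≤ H)
    {h : E2 → ℝ} (hh : ∀ x ∈ Ω, h x ≤ H ∨ root P x < H) (hc : ContinuousOn h Ω)
    (h0 : ∀ x ∈ Ω, 0 ≤ h x) (hi : Integrable (excess P) (sigma Ω h))
    (heq : ∫ x, excess P x ∂sigma Ω h ≤ ∫ x, excess P x ∂sigma Ω (surface P H)) :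
    EqOn h (surface P H) Ω := by
  have hcs := hP.continuous_surface hδ H
  have hm := (isOpen_subgraph hΩo hc).measurableSet
  have hm' := (isOpen_subgraph hΩo hcs.continuousOn).measurableSet
  have hi' : Integrable (excess P) (sigma Ω (surface P H)) :=
    integrable_sigma hΩ (fun x _ => surface_le P hH x) hP.continuous_excess
  have hle := hP.integral_surface_le hδ hΩ hΩo.measurableSet hH hh hm hi
  have hae : (subgraph Ω (surface P H)).indicator (excess P) =ᵐ[volume]
      (subgraph Ω h).indicator (excess P) := by
    refine (integral_eq_iff_of_ae_le ((integrable_indicator_iff hm').2 hi')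
      ((integrable_indicator_iff hm).2 hi)
      (Filter.Eventually.of_forall (hP.indicator_surface_le hδ hh))).1 ?_
    rw [integral_indicator hm, integral_indicator hm']
    exact le_antisymm hle heq
  have key : ∀ U : Set E3, IsOpen U → (∀ x ∈ U, (subgraph Ω (surface P H)).indicator (excess P) x ≠
      (subgraph Ω h).indicator (excess P) x) → ∀ x, x ∉ U := by
    intro U hU hne x hx
    exact (hU.measure_pos volume ⟨x, hx⟩).ne' (measure_mono_null hne (ae_iff.1 hae))
  intro x hx
  by_contra hne
  rcases lt_or_gt_of_ne hne with hlt | hlt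
  · obtain ⟨t, ht1, ht2⟩ := exists_between hlt
    refine key _ ((isOpen_subgraph hΩo hcs.continuousOn).inter (isOpen_supergraph hΩo hc)) ?_
      (lift x t) ⟨⟨?_, ?_, ?_⟩, ?_, ?_⟩
    · rintro z ⟨hz1, hz2⟩
      rw [indicator_of_mem hz1, indicator_of_notMem fun h' => lt_asymm hz2.2 h'.2.2]
      have := (hP.excess_neg_iff hδ).2 (lt_root_of_lt_surface hz1.2.1 hz1.2.2)
      rw [lift_horiz] at this
      exact this.ne
    all_goals simp only [horiz_lift, lift_two]
    · exact hx
    · exact (h0 x hx).trans_lt ht1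
    · exact ht2
    · exact hx
    · exact ht1
  · obtain ⟨t, ht1, ht2⟩ := exists_between hlt
    refine key _ ((isOpen_subgraph hΩo hc).inter (isOpen_supergraph hΩo hcs.continuousOn)) ?_
      (lift x t) ⟨⟨?_, ?_, ?_⟩, ?_, ?_⟩
    · rintro z ⟨hz1, hz2⟩
      rw [indicator_of_mem hz1, indicator_of_notMem fun h' => lt_asymm hz2.2 h'.2.2]
      obtain ⟨s, hs1, hs2⟩ := exists_between hz2.2
      have h4 := root_le_of_surface_le (hh _ hz1.1) hs1.le (hs2.trans hz1.2.2)
      have := (hP.excess_pos_iff hδ).2 (h4.trans_lt hs2)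
      rw [lift_horiz] at this
      exact this.ne
    all_goals simp only [horiz_lift, lift_two]
    · exact hx
    · exact (surface_nonneg P H x).trans_lt ht1
    · exact ht2
    · exact hx
    · exact ht1

/-- Integrals of a function bounded by `C` over two subgraphs differ by at most `C` times the
volume between the two graphs. -/
theorem integral_sigma_le_add {Ω : Set E2} (hΩ : MeasurableSet Ω)
    {h₁ h₂ : E2 → ℝ} (hm₁ : Measurable h₁) (hm₂ : Measurable h₂)
    (hi₁ : IntegrableOn h₁ Ω) (hi₂ : IntegrableOn h₂ Ω)
    (h0₁ : ∀ x, 0 ≤ h₁ x) (h0₂ : ∀ x, 0 ≤ h₂ x) {ψ : E3 → ℝ} {C : ℝ}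
    (hψ₁ : Integrable ψ (sigma Ω h₁)) (hψ₂ : Integrable ψ (sigma Ω h₂)) (hC : ∀ x, |ψ x| ≤ C) :
    ∫ x, ψ x ∂sigma Ω h₁ ≤ ∫ x, ψ x ∂sigma Ω h₂ + C * ∫ x in Ω, |h₁ x - h₂ x| := by
  set u : E2 → ℝ := fun x => max (h₁ x) (h₂ x) with hu
  set l : E2 → ℝ := fun x => min (h₁ x) (h₂ x) with hl
  have hC0 : 0 ≤ C := (abs_nonneg _).trans (hC 0)
  have hiu : IntegrableOn u Ω := Integrable.sup hi₁ hi₂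
  have hil : IntegrableOn l Ω := Integrable.inf hi₁ hi₂
  have hu0 : ∀ x, 0 ≤ u x := fun x => (h0₁ x).trans (le_max_left _ _)
  have hl0 : ∀ x, 0 ≤ l x := fun x => le_min (h0₁ x) (h0₂ x)
  have hsm₁ := measurableSet_subgraph hΩ hm₁
  have hsm₂ := measurableSet_subgraph hΩ hm₂
  have hsmu := measurableSet_subgraph hΩ (hm₁.max hm₂)
  have hsml := measurableSet_subgraph hΩ (hm₁.min hm₂)
  have hvu := sigma_real_univ hΩ hiu (fun x _ => hu0 x) hsmu
  have hvl := sigma_real_univ hΩ hil (fun x _ => hl0 x) hsml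
  have hfin : ∀ h : E2 → ℝ, IntegrableOn h Ω → (∀ x, 0 ≤ h x) → MeasurableSet (subgraph Ω h) →
      Integrable ((subgraph Ω h).indicator fun _ => (1 : ℝ)) volume := by
    intro h h1 h2 h3
    refine (integrable_indicator_iff h3).2 (integrableOn_const ?_)
    rw [volume_subgraph hΩ h1 (fun x _ => h2 x) h3]
    exact ENNReal.ofReal_ne_top
  have h1 : ∫ x in Ω, |h₁ x - h₂ x| = (∫ x in Ω, u x) - ∫ x in Ω, l x := by
    rw [← integral_sub hiu hil]
    refine integral_congr_ae (Filter.Eventually.of_forall fun x => ?_)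
    simp only [hu, hl]
    exact (max_sub_min_eq_abs' _ _).symm
  have h2 : ∀ h : E2 → ℝ, MeasurableSet (subgraph Ω h) →
      ∫ x, (subgraph Ω h).indicator (fun _ => (1 : ℝ)) x = (sigma Ω h).real univ := by
    intro h h3
    rw [integral_indicator h3]
    simp [sigma]
  have hJ₁ := (integrable_indicator_iff hsm₁).2 hψ₁
  have hJ₂ := (integrable_indicator_iff hsm₂).2 hψ₂
  have hJu := hfin u hiu hu0 hsmu
  have hJl := hfin l hil hl0 hsml
  have hJ : Integrable (fun x => C * ((subgraph Ω u).indicator (fun _ => (1 : ℝ)) x -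
      (subgraph Ω l).indicator (fun _ => (1 : ℝ)) x)) volume := (hJu.sub hJl).const_mul C
  rw [h1, ← hvu, ← hvl, ← h2 u hsmu, ← h2 l hsml, sigma, sigma, ← integral_indicator hsm₁,
    ← integral_indicator hsm₂, ← integral_sub hJu hJl, ← integral_const_mul,
    ← integral_add hJ₂ hJ]
  refine integral_mono hJ₁ (hJ₂.add hJ) fun x => ?_
  have hx := abs_le.1 (hC x)
  have hmu : x ∈ subgraph Ω u ↔ x ∈ subgraph Ω h₁ ∨ x ∈ subgraph Ω h₂ := by
    simp only [subgraph, mem_ofPred_eq, hu, lt_max_iff]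
    tauto
  have hml : x ∈ subgraph Ω l ↔ x ∈ subgraph Ω h₁ ∧ x ∈ subgraph Ω h₂ := by
    simp only [subgraph, mem_ofPred_eq, hl, lt_min_iff]
    tauto
  by_cases ha : x ∈ subgraph Ω h₁ <;> by_cases hb : x ∈ subgraph Ω h₂ <;>
    simp [hmu, hml, ha, hb] <;> linarith

/-! ### Free surfaces enclosing unit volume -/

theorem IsSteep.integrableOn_surface {δ b : ℝ} (hδ : 0 < δ) {P : E3 → ℝ} (hP : IsSteep δ b P)
    {Ω : Set E2} (hΩ : Bornology.IsBounded Ω) (H : ℝ) : IntegrableOn (surface P H) Ω :=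
  ((hP.continuous_surface hδ H).continuousOn.integrableOn_compact hΩ.isCompact_closure).mono_set
    subset_closure

/-- If the free surface encloses unit volume over `Ω`, then it stays below `H`: its oscillation is
at most `(M + b) / δ` times the diameter of `Ω`, and its mean is `1 / |Ω|`. -/
theorem IsSteep.root_lt {δ b M H : ℝ} (hδ : 0 < δ) (hb : 0 ≤ b) {P : E3 → ℝ}
    (hP : IsSteep δ b P) {Ω : Set E2} (hΩ : Bornology.IsBounded Ω) (hΩo : IsOpen Ω)
    (hM : ∀ x ∈ Ω, ‖x‖ ≤ M) (hH : 0 ≤ H)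
    (hHd : 2 / (volume Ω).toReal + (M + b) / δ * Metric.diam Ω ≤ H)
    (h1 : ∫ x in Ω, surface P H x = 1) {x : E2} (hx : x ∈ Ω) : root P x < H := by
  by_contra hle
  have hs : surface P H x = H := by rw [surface, min_eq_left (not_lt.1 hle), max_eq_right hH]
  have hM0 : 0 ≤ M := (norm_nonneg x).trans (hM x hx)
  have hvol : 0 < (volume Ω).toReal :=
    ENNReal.toReal_pos (hΩo.measure_pos volume ⟨x, hx⟩).ne' hΩ.measure_lt_top.ne
  have h2 : ∀ x' ∈ Ω, 2 / (volume Ω).toReal ≤ surface P H x' := by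
    intro x' hx'
    have h3 := hP.surface_le_add hδ hb H (hM x' hx') (hM x hx)
    have h4 : ‖x' - x‖ ≤ Metric.diam Ω := by
      rw [← dist_eq_norm]
      exact Metric.dist_le_diam_of_mem hΩ hx' hx
    have h5 : (M + b) / δ * ‖x' - x‖ ≤ (M + b) / δ * Metric.diam Ω :=
      mul_le_mul_of_nonneg_left h4 (by positivity)
    linarith
  have h3 := setIntegral_mono_on (integrableOn_const hΩ.measure_lt_top.ne)
    (hP.integrableOn_surface hδ hΩ H) hΩo.measurableSet h2
  rw [setIntegral_const, h1, measureReal_def, smul_eq_mul, mul_div_cancel₀ _ hvol.ne'] at h3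
  linarith

theorem IsSteep.exists_abs_excess_le {δ b : ℝ} {P : E3 → ℝ} (hP : IsSteep δ b P)
    {Ω : Set E2} (hΩ : Bornology.IsBounded Ω) (H : ℝ) :
    ∃ C, ∀ x ∈ OmegaH Ω H, |excess P x| ≤ C := by
  obtain ⟨C, hC⟩ := (isBounded_OmegaH hΩ H).isCompact_closure.exists_bound_of_continuousOn
    hP.continuous_excess.continuousOn
  exact ⟨C, fun x hx => hC x (subset_closure hx)⟩

/-- Adding a constant to the potential moves the free surface, and some constant makes it enclose
unit volume. -/
theorem IsSteep.exists_integral_surface_eq_one {δ b H : ℝ} (hδ : 0 < δ) {P : E3 → ℝ}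
    (hP : IsSteep δ b P) {Ω : Set E2} (hΩ : Bornology.IsBounded Ω) (hΩm : MeasurableSet Ω)
    (hH : 0 ≤ H) (hHv : 1 ≤ (volume Ω).toReal * H) :
    ∃ k, ∫ x in Ω, surface (fun z => P z + k) H x = 1 := by
  set V : ℝ → ℝ := fun k => ∫ x in Ω, surface (fun z => P z + k) H x with hV
  have hI : ∀ k, IntegrableOn (surface (fun z => P z + k) H) Ω := fun k =>
    (hP.add_const k).integrableOn_surface hδ hΩ H
  have hcont : Continuous V := by
    have hlip : LipschitzWith (Real.toNNReal ((volume Ω).toReal / δ)) V := by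
      refine LipschitzWith.of_le_add_mul _ fun k k' => ?_
      rw [Real.coe_toNNReal _ (by positivity), Real.dist_eq]
      have h1 : ∀ x ∈ Ω, surface (fun z => P z + k) H x ≤
          surface (fun z => P z + k') H x + |k - k'| / δ := by
        intro x _
        have := (hP.add_const k).abs_surface_sub_le hδ (hP.add_const k') H (η := |k - k'|)
          (fun z => by rw [add_sub_add_left_eq_sub]) x
        linarith [le_of_abs_le this]
      have hc : IntegrableOn (fun _ : E2 => |k - k'| / δ) Ω :=
        integrableOn_const hΩ.measure_lt_top.ne
      have h2 := setIntegral_mono_on (hI k) ((hI k').add hc) hΩm h1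
      simp only [Pi.add_apply] at h2
      rw [integral_add (hI k') hc, setIntegral_const, measureReal_def, smul_eq_mul] at h2
      calc V k ≤ V k' + (volume Ω).toReal * (|k - k'| / δ) := h2
        _ = _ := by ring
    exact hlip.continuous
  obtain ⟨C, hC⟩ := hP.exists_abs_excess_le hΩ H
  have hmem : ∀ x ∈ Ω, ∀ t ∈ Icc 0 H, lift x t ∈ OmegaH Ω H := fun x hx t ht =>
    ⟨by rwa [horiz_lift], ht⟩
  have hlow : V (-C) ≤ 1 := by
    refine (setIntegral_nonpos hΩm fun x hx => ?_).trans zero_le_one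
    refine max_le le_rfl ((min_le_right _ _).trans (not_lt.1 fun h => ?_))
    have h1 := ((hP.add_const (-C)).excess_neg_iff hδ).2 h
    have h2 := neg_le_of_abs_le (hC _ (hmem x hx 0 ⟨le_rfl, hH⟩))
    rw [excess_lift] at h1 h2
    linarith
  have hhigh : 1 ≤ V C := by
    refine hHv.trans ?_
    have h1 : ∀ x ∈ Ω, H ≤ surface (fun z => P z + C) H x := by
      intro x hx
      refine (le_min le_rfl (not_lt.1 fun h => ?_)).trans (le_max_right _ _)
      have h1 := ((hP.add_const C).excess_pos_iff hδ).2 h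
      have h2 := le_of_abs_le (hC _ (hmem x hx H ⟨hH, le_rfl⟩))
      rw [excess_lift] at h1 h2
      linarith
    have h2 := setIntegral_mono_on (integrableOn_const hΩ.measure_lt_top.ne) (hI C) hΩm h1
    rwa [setIntegral_const, measureReal_def, smul_eq_mul] at h2
  obtain ⟨k, hk⟩ := mem_range_of_exists_le_of_exists_ge hcont ⟨_, hlow⟩ ⟨_, hhigh⟩
  exact ⟨k, hk⟩

/-! ### The dual functional -/

theorem dual_eq {Ω : Set E2} (hΩ : Bornology.IsBounded Ω) (hΩm : MeasurableSet Ω) {δ b H : ℝ}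
    (hδ : 0 < δ) (hH : 0 ≤ H) {L : Set E3} {ν : Measure E3} (hν : ν.restrict L = ν)
    {P P' R : E3 → ℝ} (hP' : IsSteep δ b P') (heq : EqOn P P' (OmegaH Ω H))
    (hR : Integrable (excess R) ν) :
    dual Ω H L ν P R =
      ((∫ y, excess R y ∂ν + ∫ x, excess P' x ∂sigma Ω (surface P' H) : ℝ) : EReal) := by
  have hext : ∀ h : E2 → ℝ, Measurable h → (∀ x ∈ Ω, 0 ≤ h x ∧ h x ≤ H) →
      extIntegral (sigma Ω h) (excess P) = ((∫ x, excess P' x ∂sigma Ω h : ℝ) : EReal) := by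
    intro h hm hh
    rw [← extIntegral_eq_integral
      (integrable_sigma hΩ (fun x hx => (hh x hx).2) hP'.continuous_excess)]
    refine extIntegral_congr_ae ?_
    refine (ae_restrict_mem (measurableSet_subgraph hΩm hm)).mono fun x hx => ?_
    rw [excess, excess, heq (subgraph_subset_OmegaH (fun x hx => (hh x hx).2) hx)]
  have hsm : surface P' H ∈ {h : E2 → ℝ | Measurable h ∧ ∀ x ∈ Ω, 0 ≤ h x ∧ h x ≤ H} :=
    ⟨(hP'.continuous_surface hδ H).measurable,
      fun x _ => ⟨surface_nonneg _ _ _, surface_le _ hH _⟩⟩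
  have hinf : (⨅ h ∈ {h : E2 → ℝ | Measurable h ∧ ∀ x ∈ Ω, 0 ≤ h x ∧ h x ≤ H},
      extIntegral (sigma Ω h) (excess P)) =
        ((∫ x, excess P' x ∂sigma Ω (surface P' H) : ℝ) : EReal) := by
    refine le_antisymm ?_ ?_
    · rw [← hext _ hsm.1 hsm.2]
      exact iInf₂_le _ hsm
    · refine le_iInf₂ fun h hh => ?_
      rw [hext h hh.1 hh.2, EReal.coe_le_coe_iff]
      exact hP'.integral_surface_le hδ hΩ hΩm hH (fun x hx => Or.inl (hh.2 x hx).2)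
        (measurableSet_subgraph hΩm hh.1)
        (integrable_sigma hΩ (fun x hx => (hh.2 x hx).2) hP'.continuous_excess)
  rw [EReal.coe_add, ← hinf, ← extIntegral_eq_integral hR]
  conv_rhs => rw [← hν]
  rfl

theorem dual_le {Ω : Set E2} (hΩ : Bornology.IsBounded Ω) (hΩm : MeasurableSet Ω) {H : ℝ}
    {L : Set E3} {ν : Measure E3} (hν : ν.restrict L = ν) {P P' R : E3 → ℝ}
    (hP' : Continuous P') (hle : ∀ x ∈ OmegaH Ω H, P' x ≤ P x) (hR : Integrable (excess R) ν)
    {h : E2 → ℝ} (hm : Measurable h) (hh : ∀ x ∈ Ω, 0 ≤ h x ∧ h x ≤ H) :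
    dual Ω H L ν P R ≤ ((∫ y, excess R y ∂ν + ∫ x, excess P' x ∂sigma Ω h : ℝ) : EReal) := by
  have hc : Continuous (excess P') := by
    unfold excess
    fun_prop
  rw [EReal.coe_add, ← extIntegral_eq_integral hR,
    ← extIntegral_eq_integral (integrable_sigma hΩ (fun x hx => (hh x hx).2) hc)]
  conv_rhs => rw [← hν]
  refine add_le_add le_rfl ((iInf₂_le h ⟨hm, hh⟩).trans (extIntegral_mono_ae ?_))
  refine (ae_restrict_mem (measurableSet_subgraph hΩm hm)).mono fun x hx => ?_
  have := hle x (subgraph_subset_OmegaH (fun x hx => (hh x hx).2) hx)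
  simp only
  rw [excess]
  linarith

/-! ### Weak duality -/

theorem inner_eq_sum (x y : E3) : inner ℝ x y = x 0 * y 0 + x 1 * y 1 + x 2 * y 2 := by
  simp [PiLp.inner_apply, Fin.sum_univ_three, mul_comm]

theorem cost_eq (P R : E3 → ℝ) (x y : E3) :
    cost x y = excess P x + excess R y + (P x + R y - inner ℝ x y) := by
  rw [cost, excess, excess, inner_eq_sum]
  ring

theorem measurable_cost : Measurable fun p : E3 × E3 => cost p.1 p.2 := by
  have : Continuous fun p : E3 × E3 => cost p.1 p.2 := by
    unfold cost
    fun_prop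
  exact this.measurable

theorem Admissible.isProbabilityMeasure {Ω : Set E2} {ν : Measure E3} [IsProbabilityMeasure ν]
    {h : E2 → ℝ} {γ : Measure (E3 × E3)} (ha : Admissible Ω ν h γ) : IsProbabilityMeasure γ := by
  refine ⟨?_⟩
  rw [← Measure.snd_univ, ha.snd_eq, measure_univ]

theorem Admissible.ae_mem {Ω : Set E2} (hΩo : IsOpen Ω) {ν : Measure E3} {L : Set E3}
    (hν : ∀ᵐ y ∂ν, y ∈ L) {h : E2 → ℝ} {γ : Measure (E3 × E3)} (ha : Admissible Ω ν h γ) :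
    ∀ᵐ p ∂γ, p.1 ∈ subgraph Ω h ∧ p.2 ∈ L := by
  have hm := (isOpen_subgraph hΩo ha.continuousOn).measurableSet
  have h1 : ∀ᵐ x ∂γ.fst, x ∈ subgraph Ω h := ha.fst_eq ▸ ae_restrict_mem hm
  have h2 : ∀ᵐ y ∂γ.snd, y ∈ L := ha.snd_eq ▸ hν
  filter_upwards [ae_of_ae_map measurable_fst.aemeasurable h1,
    ae_of_ae_map measurable_snd.aemeasurable h2] with p h3 h4 using ⟨h3, h4⟩

theorem integrable_comp_fst {γ : Measure (E3 × E3)} {μ : Measure E3} (h : γ.fst = μ)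
    {f : E3 → ℝ} (hf : Integrable f μ) : Integrable (fun p : E3 × E3 => f p.1) γ := by
  subst h
  exact hf.comp_measurable measurable_fst

theorem integrable_comp_snd {γ : Measure (E3 × E3)} {μ : Measure E3} (h : γ.snd = μ)
    {f : E3 → ℝ} (hf : Integrable f μ) : Integrable (fun p : E3 × E3 => f p.2) γ := by
  subst h
  exact hf.comp_measurable measurable_snd

theorem integral_comp_fst {γ : Measure (E3 × E3)} {μ : Measure E3} (h : γ.fst = μ)
    {f : E3 → ℝ} (hf : Integrable f μ) : ∫ p, f p.1 ∂γ = ∫ x, f x ∂μ := by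
  subst h
  exact (integral_map measurable_fst.aemeasurable hf.aestronglyMeasurable).symm

theorem integral_comp_snd {γ : Measure (E3 × E3)} {μ : Measure E3} (h : γ.snd = μ)
    {f : E3 → ℝ} (hf : Integrable f μ) : ∫ p, f p.2 ∂γ = ∫ x, f x ∂μ := by
  subst h
  exact (integral_map measurable_snd.aemeasurable hf.aestronglyMeasurable).symm

/-- Finiteness of the energy makes the energy density of any steep potential integrable, even if
the height is unbounded. -/
theorem Admissible.integrable_excess {Ω : Set E2} (hΩ : Bornology.IsBounded Ω) (hΩo : IsOpen Ω)
    {ν : Measure E3} [IsProbabilityMeasure ν] {L : Set E3} (hν : ∀ᵐ y ∂ν, y ∈ L) {h : E2 → ℝ}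
    {γ : Measure (E3 × E3)} (ha : Admissible Ω ν h γ)
    (hcost : Integrable (fun p => cost p.1 p.2) γ) {δ b : ℝ} (hδ : 0 < δ) {P R : E3 → ℝ}
    (hP : IsSteep δ b P) (hPR : ∀ x, ∀ y ∈ L, inner ℝ x y ≤ P x + R y)
    (hR : Integrable (excess R) ν) : Integrable (excess P) (sigma Ω h) := by
  have := ha.isProbabilityMeasure
  obtain ⟨C, hC⟩ := hP.exists_abs_excess_le hΩ 0
  have hR' := integrable_comp_snd ha.snd_eq hR
  rw [← ha.fst_eq, Measure.fst, integrable_map_measure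
    hP.continuous_excess.aestronglyMeasurable measurable_fst.aemeasurable]
  refine integrable_of_le_of_le (hP.continuous_excess.comp continuous_fst).aestronglyMeasurable
    (g₁ := fun _ => -C) (g₂ := fun p => cost p.1 p.2 - excess R p.2) ?_ ?_
    (integrable_const _) (hcost.sub hR')
  · filter_upwards [ha.ae_mem hΩo hν] with p hp
    have h1 := hP.excess_add_le (horiz p.1) hp.1.2.1.le
    have h2 : 0 ≤ δ * (p.1 2 - 0) := mul_nonneg hδ.le (sub_nonneg.2 hp.1.2.1.le)
    rw [lift_horiz] at h1
    have h3 := neg_le_of_abs_le (hC (lift (horiz p.1) 0)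
      ⟨by rw [horiz_lift]; exact hp.1.1, le_rfl, le_rfl⟩)
    simp only [Function.comp]
    linarith
  · filter_upwards [ha.ae_mem hΩo hν] with p hp
    have h1 := hPR p.1 p.2 hp.2
    have h2 := cost_eq P R p.1 p.2
    simp only [Function.comp]
    linarith

/-- The energy exceeds the dual value by the integral of the slack in `x · y ≤ P x + R y`. -/
theorem Admissible.integral_cost_eq {Ω : Set E2} {ν : Measure E3} {h : E2 → ℝ}
    {γ : Measure (E3 × E3)} (ha : Admissible Ω ν h γ)
    (hcost : Integrable (fun p => cost p.1 p.2) γ) {P R : E3 → ℝ}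
    (hP : Integrable (excess P) (sigma Ω h)) (hR : Integrable (excess R) ν) :
    Integrable (fun p : E3 × E3 => P p.1 + R p.2 - inner ℝ p.1 p.2) γ ∧
      ∫ p, cost p.1 p.2 ∂γ = ∫ x, excess P x ∂sigma Ω h + ∫ y, excess R y ∂ν +
        ∫ p : E3 × E3, (P p.1 + R p.2 - inner ℝ p.1 p.2) ∂γ := by
  have h1 := integrable_comp_fst ha.fst_eq hP
  have h2 := integrable_comp_snd ha.snd_eq hR
  have h3 : Integrable (fun p : E3 × E3 => P p.1 + R p.2 - inner ℝ p.1 p.2) γ := by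
    refine ((hcost.sub h1).sub h2).congr (Filter.Eventually.of_forall fun p => ?_)
    simp only [Pi.sub_apply, cost_eq P R]
    ring
  have h4 : Integrable (fun p : E3 × E3 => excess P p.1 + excess R p.2) γ := h1.add h2
  refine ⟨h3, ?_⟩
  rw [← integral_comp_fst ha.fst_eq hP, ← integral_comp_snd ha.snd_eq hR, ← integral_add h1 h2,
    ← integral_add h4 h3]
  exact integral_congr_ae (Filter.Eventually.of_forall fun p => cost_eq P R p.1 p.2)

theorem Admissible.cost_nonneg {Ω : Set E2} (hΩo : IsOpen Ω) {ν : Measure E3} {D δ : ℝ}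
    (hδ : 0 < δ) (hν : ∀ᵐ y ∂ν, y ∈ Lam D δ) {h : E2 → ℝ} {γ : Measure (E3 × E3)}
    (ha : Admissible Ω ν h γ) : ∀ᵐ p ∂γ, 0 ≤ cost p.1 p.2 := by
  filter_upwards [ha.ae_mem hΩo hν] with p hp
  have h1 : 0 < p.1 2 := hp.1.2.1
  have h2 : p.2 2 ≤ -δ := hp.2.2.2
  rw [cost]
  nlinarith [sq_nonneg (p.1 0 - p.2 0), sq_nonneg (p.1 1 - p.2 1)]

theorem Admissible.energy_eq_top {Ω : Set E2} (hΩo : IsOpen Ω) {ν : Measure E3} {D δ : ℝ}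
    (hδ : 0 < δ) (hν : ∀ᵐ y ∂ν, y ∈ Lam D δ) {h : E2 → ℝ} {γ : Measure (E3 × E3)}
    (ha : Admissible Ω ν h γ) (hcost : ¬ Integrable (fun p => cost p.1 p.2) γ) :
    energy γ = ⊤ :=
  extIntegral_eq_top measurable_cost.aemeasurable (ha.cost_nonneg hΩo hδ hν) hcost

theorem integrable_of_continuous_of_ae_mem {ν : Measure E3} [IsFiniteMeasure ν] {L : Set E3}
    (hν : ∀ᵐ y ∂ν, y ∈ L) (hL : IsCompact L) {f : E3 → ℝ} (hf : Continuous f) :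
    Integrable f ν := by
  obtain ⟨C, hC⟩ := hL.exists_bound_of_continuousOn hf.continuousOn
  exact (integrable_const C).mono' hf.aestronglyMeasurable (hν.mono fun y hy => hC y hy)

/-- Weak duality. After raising the potential by a constant `k` such that the free surface encloses
unit volume, the surface stays below `H` and is optimal among all heights, bounded by `H` or not;
the changes `k` and `-k` of the two integrals cancel. -/
theorem dual_le_energy {Ω : Set E2} (hΩ : Bornology.IsBounded Ω) (hΩo : IsOpen Ω)
    (hΩne : Ω.Nonempty) {D δ b M H : ℝ} (hδ : 0 < δ) (hne : (Lam D δ).Nonempty)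
    (hb : ∀ y ∈ Lam D δ, ‖horiz y‖ ≤ b) (hM : ∀ x ∈ Ω, ‖x‖ ≤ M)
    (hH : 2 / (volume Ω).toReal + (M + b) / δ * Metric.diam Ω ≤ H) (hH0 : 0 ≤ H)
    (hHv : 1 ≤ (volume Ω).toReal * H)
    {ν : Measure E3} [IsProbabilityMeasure ν] (hν : ∀ᵐ y ∂ν, y ∈ Lam D δ)
    {h : E2 → ℝ} {γ : Measure (E3 × E3)} {P R : E3 → ℝ}
    (ha : Admissible Ω ν h γ) (hPR : DualAdmissible Ω H (Lam D δ) ν P R) :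
    dual Ω H (Lam D δ) ν P R ≤ energy γ := by
  have hL := isCompact_Lam D δ
  have hνr : ν.restrict (Lam D δ) = ν := Measure.restrict_eq_self_of_ae_mem hν
  have hb0 : 0 ≤ b := (norm_nonneg _).trans (hb _ hne.choose_spec)
  by_cases hcost : Integrable (fun p => cost p.1 p.2) γ
  swap
  · rw [ha.energy_eq_top hΩo hδ hν hcost]
    exact le_top
  -- `R` is bounded below by an affine function on `Λ`
  obtain ⟨x₀, hx₀⟩ := hΩne
  have hx₀' : lift x₀ 0 ∈ OmegaH Ω H := ⟨by rwa [horiz_lift], le_rfl, hH0⟩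
  obtain ⟨C, hC⟩ := hL.exists_bound_of_continuousOn (f := fun y : E3 => inner ℝ (lift x₀ 0) y)
    (by fun_prop)
  have hRlow : ∀ y ∈ Lam D δ, -C - P (lift x₀ 0) ≤ R y := fun y hy => by
    have h1 := hPR.inner_le _ hx₀' y hy
    have h2 := neg_le_of_abs_le (hC y hy)
    linarith
  have hRm : AEMeasurable (excess R) ν := by
    have h1 : AEMeasurable R ν := hνr ▸ hPR.aemeasurable_right
    have h2 : Measurable fun y : E3 => (1 / 2) * (y 0 ^ 2 + y 1 ^ 2) := by fun_prop
    exact h2.aemeasurable.sub h1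
  by_cases hR : Integrable (excess R) ν
  swap
  · obtain ⟨C', hC'⟩ := hL.exists_bound_of_continuousOn
      (f := fun y : E3 => (1 / 2) * (y 0 ^ 2 + y 1 ^ 2)) (by fun_prop)
    have h1 : extIntegral ν (excess R) = ⊥ := by
      refine extIntegral_eq_bot hRm (C := C' + (C + P (lift x₀ 0))) ?_ hR
      filter_upwards [hν] with y hy
      have h1 := hRlow y hy
      have h2 := le_of_abs_le (hC' y hy)
      rw [excess]
      linarith
    have h2 : dual Ω H (Lam D δ) ν P R = ⊥ := by
      have : dual Ω H (Lam D δ) ν P R = extIntegral (ν.restrict (Lam D δ)) (excess R) + _ := rfl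
      rw [this, hνr, h1, EReal.bot_add]
    rw [h2]
    exact bot_le
  set Q := legendre (Lam D δ) R with hQ
  have hQs : IsSteep δ b Q := IsSteep.legendre_Lam hne hb hRlow
  have hQP : ∀ x ∈ OmegaH Ω H, Q x ≤ P x := fun x hx =>
    legendre_le hne fun y hy => by linarith [hPR.inner_le x hx y hy]
  obtain ⟨k, hk⟩ := hQs.exists_integral_surface_eq_one hδ hΩ hΩo.measurableSet hH0 hHv
  set Q' : E3 → ℝ := fun z => Q z + k with hQ'
  have hQs' : IsSteep δ b Q' := hQs.add_const k
  have hroot : ∀ x ∈ Ω, h x ≤ H ∨ root Q' x < H := fun x hx =>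
    Or.inr (hQs'.root_lt hδ hb0 hΩ hΩo hM hH0 hH hk hx)
  have hR' : Integrable (excess fun y => R y - k) ν :=
    (hR.add (integrable_const k)).congr (Filter.Eventually.of_forall fun y => by
      simp only [Pi.add_apply, excess]
      ring)
  have hslack : ∀ x, ∀ y ∈ Lam D δ, inner ℝ x y ≤ Q' x + (R y - k) := fun x y hy => by
    have := le_legendre hL.isBounded hRlow x hy
    simp only [hQ']
    linarith
  have hi := ha.integrable_excess hΩ hΩo hν hcost hδ hQs' hslack hR'
  have hsc := hQs'.continuous_surface hδ H
  have hsb : ∀ x ∈ Ω, 0 ≤ surface Q' H x ∧ surface Q' H x ≤ H := fun x _ =>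
    ⟨surface_nonneg _ _ _, surface_le _ hH0 _⟩
  refine (dual_le hΩ hΩo.measurableSet hνr hQs.continuous hQP hR hsc.measurable hsb).trans ?_
  rw [energy, extIntegral_eq_integral hcost, EReal.coe_le_coe_iff]
  obtain ⟨-, h2⟩ := ha.integral_cost_eq hcost hi hR'
  have h3 : 0 ≤ ∫ p : E3 × E3, (Q' p.1 + (R p.2 - k) - inner ℝ p.1 p.2) ∂γ :=
    integral_nonneg_of_ae ((ha.ae_mem hΩo hν).mono fun p hp =>
      sub_nonneg.2 (hslack p.1 p.2 hp.2))
  have h4 := hQs'.integral_surface_le hδ hΩ hΩo.measurableSet hH0 hroot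
    (isOpen_subgraph hΩo ha.continuousOn).measurableSet hi
  have hmass : (sigma Ω (surface Q' H)).real univ = 1 := by
    rw [← hk]
    exact sigma_real_univ hΩo.measurableSet (hQs'.integrableOn_surface hδ hΩ H)
      (fun x hx => (hsb x hx).1) (measurableSet_subgraph hΩo.measurableSet hsc.measurable)
  have h5 : ∫ x, excess Q x ∂sigma Ω (surface Q' H) =
      ∫ x, excess Q' x ∂sigma Ω (surface Q' H) + k := by
    have hint := integrable_sigma (f := excess Q') hΩ (fun x hx => (hsb x hx).2)
      hQs'.continuous_excess
    have hintk := integrable_sigma (f := fun _ => k) hΩ (fun x hx => (hsb x hx).2)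
      continuous_const
    have : excess Q = fun x => excess Q' x + k := by
      funext x
      simp only [excess, hQ']
      ring
    rw [this, integral_add hint hintk, integral_const, hmass, one_smul]
  have h6 : ∫ y, excess (fun y => R y - k) y ∂ν = ∫ y, excess R y ∂ν + k := by
    have : (excess fun y => R y - k) = fun y => excess R y + k := by
      funext y
      simp only [excess]
      ring
    rw [this, integral_add hR (integrable_const k), integral_const]
    simp
  linarith

/-! ### Gradients at contact points -/

/-- Where an affine function touches a differentiable function from below, its slope is the
gradient. -/
theorem gradient_eq_of_touching {f : E3 → ℝ} {x y : E3} {c : ℝ} (hf : DifferentiableAt ℝ f x)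
    (hle : ∀ᶠ z in nhds x, inner ℝ z y - c ≤ f z) (hx : inner ℝ x y - c = f x) :
    gradient f x = y := by
  have h1 : HasFDerivAt f (InnerProductSpace.toDual ℝ E3 (gradient f x)) x :=
    hf.hasGradientAt.hasFDerivAt
  have h2 : HasFDerivAt (fun z : E3 => inner ℝ z y) (InnerProductSpace.toDual ℝ E3 y) x := by
    have := (InnerProductSpace.toDual ℝ E3 y).hasFDerivAt (x := x)
    refine this.congr_of_eventuallyEq (Filter.Eventually.of_forall fun z => ?_)
    simp [real_inner_comm]
  have hmin : IsLocalMin (fun z => f z - inner ℝ z y) x :=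
    hle.mono fun z hz => by linarith
  have h3 := hmin.hasFDerivAt_eq_zero (h1.sub h2)
  exact (InnerProductSpace.toDual ℝ E3).injective (sub_eq_zero.1 h3)

theorem measurable_gradient (f : E3 → ℝ) : Measurable (gradient f) :=
  (InnerProductSpace.toDual ℝ E3).symm.continuous.measurable.comp (measurable_fderiv ℝ f)

theorem exists_legendre_eq {L : Set E3} (hL : IsCompact L) (hne : L.Nonempty) {R : E3 → ℝ}
    (hR : Continuous R) (x : E3) : ∃ y ∈ L, inner ℝ x y - R y = legendre L R x := by
  obtain ⟨y, hy, hmax⟩ := hL.exists_isMaxOn hne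
    (f := fun y => inner ℝ x y - R y) (by fun_prop)
  obtain ⟨c, hc⟩ := hL.bddBelow_image hR.continuousOn
  refine ⟨y, hy, le_antisymm (le_legendre hL.isBounded (c := c)
    (fun z hz => hc ⟨z, hz, rfl⟩) x hy) (legendre_le hne fun z hz => hmax hz)⟩

theorem le_legendre_of_continuous {L : Set E3} (hL : IsCompact L) {R : E3 → ℝ}
    (hR : Continuous R) (x : E3) {y : E3} (hy : y ∈ L) : inner ℝ x y - R y ≤ legendre L R x := by
  obtain ⟨c, hc⟩ := hL.bddBelow_image hR.continuousOn
  exact le_legendre hL.isBounded (c := c) (fun z hz => hc ⟨z, hz, rfl⟩) x hy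

theorem eq_gradient_of_contact {L : Set E3} (hL : IsCompact L) {R : E3 → ℝ} (hR : Continuous R)
    {x y : E3} (hd : DifferentiableAt ℝ (legendre L R) x) (hy : y ∈ L)
    (hxy : inner ℝ x y - R y = legendre L R x) : gradient (legendre L R) x = y :=
  gradient_eq_of_touching hd
    (Filter.Eventually.of_forall fun z => le_legendre_of_continuous hL hR z hy) hxy

theorem gradient_legendre_contact {L : Set E3} (hL : IsCompact L) (hne : L.Nonempty)
    {R : E3 → ℝ} (hR : Continuous R) {x : E3} (hd : DifferentiableAt ℝ (legendre L R) x) :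
    gradient (legendre L R) x ∈ L ∧
      inner ℝ x (gradient (legendre L R) x) - R (gradient (legendre L R) x) = legendre L R x := by
  obtain ⟨y, hy, hxy⟩ := exists_legendre_eq hL hne hR x
  rw [eq_gradient_of_contact hL hR hd hy hxy]
  exact ⟨hy, hxy⟩

/-! ### First variation of the conjugate -/

theorem abs_legendre_sub_le {L : Set E3} (hL : IsCompact L) (hne : L.Nonempty) {R R' : E3 → ℝ}
    (hR : Continuous R) (hR' : Continuous R') {η : ℝ} (h : ∀ y, |R y - R' y| ≤ η) (x : E3) :
    |legendre L R x - legendre L R' x| ≤ η := by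
  have h1 : legendre L R x ≤ legendre L R' x + η := legendre_le hne fun y hy => by
    linarith [le_legendre_of_continuous hL hR' x hy, neg_le_of_abs_le (h y)]
  have h2 : legendre L R' x ≤ legendre L R x + η := legendre_le hne fun y hy => by
    linarith [le_legendre_of_continuous hL hR x hy, le_of_abs_le (h y)]
  rw [abs_le]
  constructor <;> linarith

open Filter Topology in
/-- The derivative of `ε ↦ legendre L (R + ε φ) x` at `0` is `-φ (∇ (legendre L R) x)`: away from
the unique contact point of `x`, the slack in the conjugacy inequality is bounded below. -/
theorem tendsto_legendre_variation {L : Set E3} (hL : IsCompact L) (hne : L.Nonempty)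
    {R φ : E3 → ℝ} (hR : Continuous R) (hφ : Continuous φ) {C : ℝ} (hC : ∀ y, |φ y| ≤ C)
    {x : E3} (hd : DifferentiableAt ℝ (legendre L R) x) :
    Tendsto (fun ε : ℝ => (legendre L R x - legendre L (fun y => R y + ε * φ y) x) / ε)
      (𝓝[>] 0) (𝓝 (φ (gradient (legendre L R) x))) := by
  obtain ⟨hy₀, hxy₀⟩ := gradient_legendre_contact hL hne hR hd
  set y₀ := gradient (legendre L R) x with hy₀_def
  have hRε : ∀ ε : ℝ, Continuous fun y => R y + ε * φ y := fun ε => by fun_prop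
  have hlow : ∀ η > 0, ∀ᶠ ε : ℝ in 𝓝[>] 0,
      φ y₀ - η ≤ (legendre L R x - legendre L (fun y => R y + ε * φ y) x) / ε := by
    intro η hη
    have hK : IsCompact (L ∩ {y | φ y ≤ φ y₀ - η}) :=
      hL.inter_right (isClosed_le hφ continuous_const)
    obtain ⟨m, hm, hmK⟩ : ∃ m > 0, ∀ y ∈ L, φ y ≤ φ y₀ - η →
        m ≤ legendre L R x - (inner ℝ x y - R y) := by
      rcases (L ∩ {y | φ y ≤ φ y₀ - η}).eq_empty_or_nonempty with hemp | hnon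
      · exact ⟨1, one_pos, fun y hy h => absurd (show y ∈ L ∩ {y | φ y ≤ φ y₀ - η} from ⟨hy, h⟩)
          (by rw [hemp]; exact notMem_empty y)⟩
      · obtain ⟨z, hz, hmin⟩ := hK.exists_isMinOn hnon
          (f := fun y => legendre L R x - (inner ℝ x y - R y)) (by fun_prop)
        refine ⟨_, ?_, fun y hy h => hmin ⟨hy, h⟩⟩
        refine sub_pos.2 (lt_of_le_of_ne (le_legendre_of_continuous hL hR x hz.1) fun heq => ?_)
        have h1 := eq_gradient_of_contact hL hR hd hz.1 heq
        have h2 : φ z ≤ φ y₀ - η := hz.2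
        rw [← h1] at h2
        linarith
    have hC0 : 0 ≤ C := (abs_nonneg _).trans (hC 0)
    have hsmall : ∀ᶠ ε : ℝ in 𝓝[>] 0, ε < m / (2 * C + 1) :=
      Filter.Eventually.filter_mono nhdsWithin_le_nhds (gt_mem_nhds (by positivity))
    filter_upwards [hsmall, self_mem_nhdsWithin] with ε hε hε0
    have hε0 : 0 < ε := hε0
    rw [lt_div_iff₀ (by positivity)] at hε
    rw [le_div_iff₀ hε0]
    suffices h : legendre L (fun y => R y + ε * φ y) x ≤ legendre L R x - (φ y₀ - η) * ε by
      linarith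
    refine legendre_le hne fun y hy => ?_
    rcases le_total (φ y) (φ y₀ - η) with h | h
    · have h1 := hmK y hy h
      have h2 := (abs_le.1 (hC y)).1
      have h3 := (abs_le.1 (hC y₀)).2
      nlinarith
    · have h1 := le_legendre_of_continuous hL hR x hy
      nlinarith
  have hup : ∀ᶠ ε : ℝ in 𝓝[>] 0,
      (legendre L R x - legendre L (fun y => R y + ε * φ y) x) / ε ≤ φ y₀ := by
    filter_upwards [self_mem_nhdsWithin] with ε hε0
    rw [div_le_iff₀ hε0]
    have := le_legendre_of_continuous hL (hRε ε) x hy₀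
    linarith
  refine tendsto_order.2 ⟨fun a ha => ?_, fun a ha => hup.mono fun ε h => h.trans_lt ha⟩
  refine (hlow ((φ y₀ - a) / 2) (by linarith)).mono fun ε h => lt_of_lt_of_le ?_ h
  linarith

theorem abs_legendre_variation_le {L : Set E3} (hL : IsCompact L) (hne : L.Nonempty)
    {R φ : E3 → ℝ} (hR : Continuous R) (hφ : Continuous φ) {C : ℝ} (hC : ∀ y, |φ y| ≤ C)
    {ε : ℝ} (hε : 0 < ε) (x : E3) :
    |legendre L R x - legendre L (fun y => R y + ε * φ y) x| ≤ ε * C := by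
  refine abs_legendre_sub_le hL hne hR (by fun_prop) (fun y => ?_) x
  rw [sub_add_cancel_left, abs_neg, abs_mul, abs_of_pos hε]
  exact mul_le_mul_of_nonneg_left (hC y) hε.le

/-! ### First variation of the dual functional -/

theorem IsSteep.ae_differentiableAt {δ b : ℝ} {P : E3 → ℝ} (hP : IsSteep δ b P) (Ω : Set E2)
    (h : E2 → ℝ) : ∀ᵐ x ∂sigma Ω h, DifferentiableAt ℝ P x := by
  obtain ⟨K, hK⟩ := hP.lipschitz
  exact ae_restrict_of_ae hK.ae_differentiableAt

theorem isFiniteMeasure_sigma {Ω : Set E2} (hΩ : Bornology.IsBounded Ω) {h : E2 → ℝ} {H : ℝ}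
    (hh : ∀ x ∈ Ω, h x ≤ H) : IsFiniteMeasure (sigma Ω h) := by
  refine isFiniteMeasure_restrict.2 (ne_top_of_le_ne_top ?_
    (measure_mono (subgraph_subset_OmegaH hh)))
  exact (isBounded_OmegaH hΩ H).measure_lt_top.ne

open Filter Topology in
/-- One half of the Euler-Lagrange equation: the maximum is compared with the value at `R + ε φ`.
Freezing the surface of the varied potential costs only `O(ε²)`, because the two potentials differ
by `O(ε)` and the volume between their surfaces is `O(ε)`. -/
theorem integral_comp_gradient_le {Ω : Set E2} (hΩ : Bornology.IsBounded Ω) (hΩo : IsOpen Ω)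
    {D δ b H : ℝ} (hδ : 0 < δ) (hH : 0 ≤ H) (hne : (Lam D δ).Nonempty)
    (hb : ∀ y ∈ Lam D δ, ‖horiz y‖ ≤ b) {ν : Measure E3} [IsProbabilityMeasure ν]
    (hν : ∀ᵐ y ∂ν, y ∈ Lam D δ) {R : E3 → ℝ} (hR : Continuous R)
    (hmax : ∀ R' : E3 → ℝ, Continuous R' →
      ∫ y, excess R' y ∂ν + ∫ x, excess (legendre (Lam D δ) R') x
          ∂sigma Ω (surface (legendre (Lam D δ) R') H) ≤
        ∫ y, excess R y ∂ν + ∫ x, excess (legendre (Lam D δ) R) x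
          ∂sigma Ω (surface (legendre (Lam D δ) R) H))
    {φ : E3 → ℝ} (hφ : Continuous φ) {C : ℝ} (hC : ∀ y, |φ y| ≤ C) :
    ∫ x, φ (gradient (legendre (Lam D δ) R) x) ∂sigma Ω (surface (legendre (Lam D δ) R) H) ≤
      ∫ y, φ y ∂ν := by
  have hL := isCompact_Lam D δ
  have hsteep : ∀ R' : E3 → ℝ, Continuous R' → IsSteep δ b (legendre (Lam D δ) R') := by
    intro R' hR'
    obtain ⟨c, hc⟩ := hL.bddBelow_image hR'.continuousOn
    exact IsSteep.legendre_Lam hne hb (c := c) fun y hy => hc ⟨y, hy, rfl⟩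
  set P := legendre (Lam D δ) R with hPdef
  set Pε : ℝ → E3 → ℝ := fun ε => legendre (Lam D δ) fun y => R y + ε * φ y with hPε
  have hP : IsSteep δ b P := hsteep R hR
  have hRc : ∀ ε : ℝ, Continuous fun y => R y + ε * φ y := fun ε => by fun_prop
  have hPs : ∀ ε, IsSteep δ b (Pε ε) := fun ε => hsteep _ (hRc ε)
  have hsH : ∀ Q : E3 → ℝ, ∀ x ∈ Ω, surface Q H x ≤ H := fun Q x _ => surface_le Q hH x
  have := isFiniteMeasure_sigma hΩ (hsH P)
  have hclose : ∀ ε : ℝ, 0 < ε → ∀ x, |P x - Pε ε x| ≤ ε * C := fun ε hε x =>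
    abs_legendre_variation_le hL hne hR hφ hC hε x
  have hcd : ∀ ε : ℝ, Continuous fun x => P x - Pε ε x := fun ε =>
    hP.continuous.sub (hPs ε).continuous
  have hbound : ∀ᶠ ε : ℝ in 𝓝[>] 0, ∫ x, (P x - Pε ε x) / ε ∂sigma Ω (surface P H) ≤
      ∫ y, φ y ∂ν + C * ((volume Ω).toReal * (ε * C / δ)) := by
    filter_upwards [self_mem_nhdsWithin] with ε hε0
    have hε0 : 0 < ε := hε0
    rw [integral_div, div_le_iff₀ hε0]
    have h1 := hmax _ (hRc ε)
    have hexR : Integrable (excess R) ν := integrable_of_continuous_of_ae_mem hν hL (by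
      unfold excess
      fun_prop)
    have hφi : Integrable φ ν := integrable_of_continuous_of_ae_mem hν hL hφ
    have h2 : ∫ y, excess (fun y => R y + ε * φ y) y ∂ν =
        ∫ y, excess R y ∂ν - ε * ∫ y, φ y ∂ν := by
      rw [← integral_const_mul, ← integral_sub hexR (hφi.const_mul ε)]
      congr 1
      funext y
      simp only [excess]
      ring
    have hiP : Integrable (excess P) (sigma Ω (surface (Pε ε) H)) :=
      integrable_sigma hΩ (hsH _) hP.continuous_excess
    have hiPε : Integrable (excess (Pε ε)) (sigma Ω (surface (Pε ε) H)) :=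
      integrable_sigma hΩ (hsH _) (hPs ε).continuous_excess
    have h3 := hP.integral_surface_le hδ hΩ hΩo.measurableSet hH
      (h := surface (Pε ε) H) (fun x hx => Or.inl (hsH _ x hx))
      (measurableSet_subgraph hΩo.measurableSet ((hPs ε).continuous_surface hδ H).measurable) hiP
    have h4 : ∫ x, (P x - Pε ε x) ∂sigma Ω (surface (Pε ε) H) =
        ∫ x, excess (Pε ε) x ∂sigma Ω (surface (Pε ε) H) -
          ∫ x, excess P x ∂sigma Ω (surface (Pε ε) H) := by
      rw [← integral_sub hiPε hiP]
      congr 1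
      funext x
      simp only [excess]
      ring
    have h5 := integral_sigma_le_add hΩo.measurableSet
      (hP.continuous_surface hδ H).measurable ((hPs ε).continuous_surface hδ H).measurable
      (hP.integrableOn_surface hδ hΩ H) ((hPs ε).integrableOn_surface hδ hΩ H)
      (surface_nonneg _ _) (surface_nonneg _ _)
      (integrable_sigma hΩ (hsH _) (hcd ε)) (integrable_sigma hΩ (hsH _) (hcd ε)) (hclose ε hε0)
    have h6 : ∫ x in Ω, |surface P H x - surface (Pε ε) H x| ≤
        (volume Ω).toReal * (ε * C / δ) := by
      have := setIntegral_mono_on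
        ((hP.integrableOn_surface hδ hΩ H).sub ((hPs ε).integrableOn_surface hδ hΩ H)).abs
        (integrableOn_const (C := ε * C / δ) hΩ.measure_lt_top.ne) hΩo.measurableSet
        fun x _ => hP.abs_surface_sub_le hδ (hPs ε) H (hclose ε hε0) x
      rwa [setIntegral_const, measureReal_def, smul_eq_mul] at this
    have hC0 : 0 ≤ C := (abs_nonneg _).trans (hC 0)
    have h7 := mul_le_mul_of_nonneg_left h6 (mul_nonneg hε0.le hC0)
    rw [h2] at h1
    nlinarith
  have hlim1 : Tendsto (fun ε : ℝ => ∫ x, (P x - Pε ε x) / ε ∂sigma Ω (surface P H)) (𝓝[>] 0)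
      (𝓝 (∫ x, φ (gradient P x) ∂sigma Ω (surface P H))) := by
    refine tendsto_integral_filter_of_dominated_convergence (fun _ => C)
      (Filter.Eventually.of_forall fun ε => ((hcd ε).div_const ε).aestronglyMeasurable) ?_
      (integrable_const C) ?_
    · filter_upwards [self_mem_nhdsWithin] with ε hε0
      have hε0 : 0 < ε := hε0
      refine Filter.Eventually.of_forall fun x => ?_
      rw [Real.norm_eq_abs, abs_div, abs_of_pos hε0, div_le_iff₀ hε0, mul_comm]
      exact hclose ε hε0 x
    · exact (hP.ae_differentiableAt Ω _).mono fun x hx =>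
        tendsto_legendre_variation hL hne hR hφ hC hx
  have hlim2 : Tendsto (fun ε : ℝ => ∫ y, φ y ∂ν + C * ((volume Ω).toReal * (ε * C / δ)))
      (𝓝[>] 0) (𝓝 (∫ y, φ y ∂ν)) := by
    have h : Continuous fun ε : ℝ => ∫ y, φ y ∂ν + C * ((volume Ω).toReal * (ε * C / δ)) := by
      fun_prop
    have := (h.tendsto 0).mono_left (nhdsWithin_le_nhds (s := Ioi 0))
    simpa using this
  exact le_of_tendsto_of_tendsto hlim1 hlim2 hbound

/-- The Euler-Lagrange equation of the dual problem: at a maximizer, the gradient of the potential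
transports the fluid measure to `ν`. -/
theorem map_gradient_eq {Ω : Set E2} (hΩ : Bornology.IsBounded Ω) (hΩo : IsOpen Ω)
    {D δ b H : ℝ} (hδ : 0 < δ) (hH : 0 ≤ H) (hne : (Lam D δ).Nonempty)
    (hb : ∀ y ∈ Lam D δ, ‖horiz y‖ ≤ b) {ν : Measure E3} [IsProbabilityMeasure ν]
    (hν : ∀ᵐ y ∂ν, y ∈ Lam D δ) {R : E3 → ℝ} (hR : Continuous R)
    (hmax : ∀ R' : E3 → ℝ, Continuous R' →
      ∫ y, excess R' y ∂ν + ∫ x, excess (legendre (Lam D δ) R') x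
          ∂sigma Ω (surface (legendre (Lam D δ) R') H) ≤
        ∫ y, excess R y ∂ν + ∫ x, excess (legendre (Lam D δ) R) x
          ∂sigma Ω (surface (legendre (Lam D δ) R) H)) :
    (sigma Ω (surface (legendre (Lam D δ) R) H)).map (gradient (legendre (Lam D δ) R)) = ν := by
  have hfin : IsFiniteMeasure (sigma Ω (surface (legendre (Lam D δ) R) H)) :=
    isFiniteMeasure_sigma hΩ fun x _ => surface_le _ hH x
  refine ext_of_forall_integral_eq_of_IsFiniteMeasure fun φ => ?_
  rw [integral_map (measurable_gradient _).aemeasurable φ.continuous.aestronglyMeasurable]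
  have h1 := integral_comp_gradient_le hΩ hΩo hδ hH hne hb hν hR hmax φ.continuous
    (C := ‖φ‖) φ.norm_coe_le_norm
  have h2 := integral_comp_gradient_le hΩ hΩo hδ hH hne hb hν hR hmax
    (φ := fun y => -φ y) φ.continuous.neg (C := ‖φ‖) fun y => by
      rw [abs_neg]
      exact φ.norm_coe_le_norm y
  rw [integral_neg, integral_neg] at h2
  exact le_antisymm h1 (neg_le_neg_iff.1 h2)

/-! ### Optimal pairs -/

theorem OmegaH_mem_nhds {Ω : Set E2} (hΩo : IsOpen Ω) {h : E2 → ℝ} {H : ℝ}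
    (hh : ∀ x ∈ Ω, h x ≤ H) {x : E3} (hx : x ∈ subgraph Ω h) : OmegaH Ω H ∈ nhds x := by
  have h1 : IsOpen (subgraph Ω fun _ => H) := isOpen_subgraph hΩo continuousOn_const
  have h2 : x ∈ subgraph Ω fun _ => H := ⟨hx.1, hx.2.1, hx.2.2.trans_le (hh _ hx.1)⟩
  exact Filter.mem_of_superset (h1.mem_nhds h2) (subgraph_subset_OmegaH fun _ _ => le_rfl)

theorem ae_gradient_eq {Ω : Set E2} (hΩo : IsOpen Ω) {h : E2 → ℝ} (hc : ContinuousOn h Ω)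
    {H : ℝ} (hh : ∀ x ∈ Ω, h x ≤ H) {P Q : E3 → ℝ} (hPQ : EqOn P Q (OmegaH Ω H)) :
    ∀ᵐ x ∂sigma Ω h, gradient P x = gradient Q x := by
  refine (ae_restrict_mem (isOpen_subgraph hΩo hc).measurableSet).mono fun x hx => ?_
  exact (hPQ.eventuallyEq_of_mem (OmegaH_mem_nhds hΩo hh hx)).gradient_eq

theorem ConvexConjugate.eqOn_legendre {A B : Set E3} {P R : E3 → ℝ} (hB : B.Nonempty)
    (h : ConvexConjugate A B P R) : EqOn P (legendre B R) A := fun x hx =>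
  ((h.1 x hx).csSup_eq (hB.image _)).symm

theorem ConvexConjugate.symm {A B : Set E3} {P R : E3 → ℝ} (h : ConvexConjugate A B P R) :
    ConvexConjugate B A R P := by
  refine ⟨fun y hy => ?_, fun x hx => ?_⟩
  · simpa only [real_inner_comm] using h.2 y hy
  · simpa only [real_inner_comm] using h.1 x hx

theorem legendre_congr {B : Set E3} {g g' : E3 → ℝ} (h : EqOn g g' B) :
    legendre B g = legendre B g' := by
  funext x
  rw [legendre, legendre]
  congr 1
  exact image_congr fun y hy => by rw [h hy]

theorem measurable_graph {T : E3 → E3} (hT : Measurable T) : Measurable fun x => (x, T x) :=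
  measurable_id.prodMk hT

/-- A measure on a product that is concentrated on the graph of `T` is determined by its first
marginal. -/
theorem eq_map_fst_of_ae_eq {γ : Measure (E3 × E3)} {T : E3 → E3} (hT : Measurable T)
    (h : ∀ᵐ p ∂γ, p.2 = T p.1) : γ = γ.fst.map fun x => (x, T x) := by
  rw [Measure.fst, Measure.map_map (measurable_graph hT) measurable_fst]
  conv_lhs => rw [← Measure.map_id (μ := γ)]
  exact Measure.map_congr (h.mono fun p hp => Prod.ext rfl hp)

theorem fst_map_graph {μ : Measure E3} {T : E3 → E3} (hT : Measurable T) :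
    (μ.map fun x => (x, T x)).fst = μ := by
  rw [Measure.fst, Measure.map_map measurable_fst (measurable_graph hT)]
  exact Measure.map_id

theorem snd_map_graph {μ : Measure E3} {T : E3 → E3} (hT : Measurable T) :
    (μ.map fun x => (x, T x)).snd = μ.map T := by
  rw [Measure.snd, Measure.map_map measurable_snd (measurable_graph hT)]
  rfl

/-- A potential whose gradient transports the fluid below its free surface to the probability
measure `ν` has a free surface enclosing unit volume. -/
theorem IsSteep.integral_surface_eq_one {δ b : ℝ} (hδ : 0 < δ) {Q : E3 → ℝ} (hQ : IsSteep δ b Q)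
    {Ω : Set E2} (hΩ : Bornology.IsBounded Ω) (hΩm : MeasurableSet Ω) {H : ℝ} {ν : Measure E3}
    [IsProbabilityMeasure ν] (hmap : (sigma Ω (surface Q H)).map (gradient Q) = ν) :
    ∫ x in Ω, surface Q H x = 1 := by
  rw [← sigma_real_univ hΩm (hQ.integrableOn_surface hδ hΩ H) (fun x _ => surface_nonneg _ _ _)
    (measurableSet_subgraph hΩm (hQ.continuous_surface hδ H).measurable), measureReal_def,
    ← preimage_univ (f := gradient Q), ← Measure.map_apply (measurable_gradient _)
    MeasurableSet.univ, hmap, measure_univ, ENNReal.toReal_one]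

/-- The optimal plan: the graph of the gradient over the fluid region is admissible, and its
energy attains the dual value because it is concentrated on contact points. -/
theorem admissible_graph {Ω : Set E2} (hΩ : Bornology.IsBounded Ω) (hΩo : IsOpen Ω)
    {δ b H : ℝ} (hδ : 0 < δ) (hH : 0 ≤ H) {L : Set E3} (hL : IsCompact L) (hne : L.Nonempty)
    {ν : Measure E3} [IsProbabilityMeasure ν] (hν : ∀ᵐ y ∂ν, y ∈ L) {P R : E3 → ℝ}
    (hR : Continuous R) (hQ : IsSteep δ b (legendre L R))
    (hPQ : EqOn P (legendre L R) (OmegaH Ω H))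
    (hmap : (sigma Ω (surface (legendre L R) H)).map (gradient (legendre L R)) = ν)
    {h : E2 → ℝ} (hh : EqOn h (surface (legendre L R) H) Ω) :
    Admissible Ω ν h ((sigma Ω h).map fun x => (x, gradient P x)) ∧
      (∀ᵐ p ∂(sigma Ω h).map fun x => (x, gradient P x),
        p.2 ∈ L ∧ inner ℝ p.1 p.2 - R p.2 = legendre L R p.1) ∧
      energy ((sigma Ω h).map fun x => (x, gradient P x)) =
        ((∫ y, excess R y ∂ν + ∫ x, excess (legendre L R) x
          ∂sigma Ω (surface (legendre L R) H) : ℝ) : EReal) := by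
  set Q := legendre L R with hQdef
  have hsc := hQ.continuous_surface hδ H
  have hsH : ∀ x ∈ Ω, surface Q H x ≤ H := fun x _ => surface_le Q hH x
  have hgP := measurable_gradient P
  have hgm : Measurable fun x => (x, gradient P x) := measurable_graph hgP
  have hgr : ∀ᵐ x ∂sigma Ω h, gradient P x = gradient Q x := by
    rw [sigma_congr hh]
    exact ae_gradient_eq hΩo hsc.continuousOn hsH hPQ
  have hadm : Admissible Ω ν h ((sigma Ω h).map fun x => (x, gradient P x)) :=
    { nonneg := fun x hx => by rw [hh hx]; exact surface_nonneg _ _ _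
      continuousOn := hsc.continuousOn.congr hh
      integral_eq := by
        rw [setIntegral_congr_fun hΩo.measurableSet hh]
        exact hQ.integral_surface_eq_one hδ hΩ hΩo.measurableSet hmap
      fst_eq := fst_map_graph hgP
      snd_eq := by rw [snd_map_graph hgP, Measure.map_congr hgr, sigma_congr hh, hmap] }
  have hcontact : ∀ᵐ p ∂(sigma Ω h).map fun x => (x, gradient P x),
      p.2 ∈ L ∧ inner ℝ p.1 p.2 - R p.2 = Q p.1 := by
    have hms : MeasurableSet {p : E3 × E3 | p.2 ∈ L ∧ inner ℝ p.1 p.2 - R p.2 = Q p.1} := by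
      have h1 : Continuous fun p : E3 × E3 => inner ℝ p.1 p.2 - R p.2 := by fun_prop
      exact ((hL.isClosed.preimage continuous_snd).inter
        (isClosed_eq h1 (hQ.continuous.comp continuous_fst))).measurableSet
    rw [ae_map_iff hgm.aemeasurable hms]
    filter_upwards [hgr, hQ.ae_differentiableAt Ω h] with x hx hd
    rw [hx]
    exact gradient_legendre_contact hL hne hR hd
  refine ⟨hadm, hcontact, ?_⟩
  have hiQ : Integrable (excess Q) (sigma Ω h) :=
    integrable_sigma hΩ (fun x hx => (hh hx).le.trans (hsH x hx)) hQ.continuous_excess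
  have hiR : Integrable (excess R) ν := integrable_of_continuous_of_ae_mem hν hL (by
    unfold excess
    fun_prop)
  have hslack : ∀ᵐ p ∂(sigma Ω h).map fun x => (x, gradient P x),
      Q p.1 + R p.2 - inner ℝ p.1 p.2 = 0 := hcontact.mono fun p hp => by linarith [hp.2]
  have hcost : Integrable (fun p : E3 × E3 => cost p.1 p.2)
      ((sigma Ω h).map fun x => (x, gradient P x)) := by
    refine ((integrable_comp_fst hadm.fst_eq hiQ).add
      (integrable_comp_snd hadm.snd_eq hiR)).congr (hslack.mono fun p hp => ?_)
    simp only [Pi.add_apply]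
    rw [cost_eq Q R, hp, add_zero]
  obtain ⟨-, h2⟩ := hadm.integral_cost_eq hcost hiQ hiR
  rw [integral_congr_ae hslack, integral_zero, add_zero, add_comm] at h2
  rw [energy, extIntegral_eq_integral hcost, h2, sigma_congr hh]

/-- Complementary slackness: an admissible pair whose energy equals the dual value has the free
surface as its height and is concentrated on the graph of the gradient. -/
theorem Admissible.eq_graph {Ω : Set E2} (hΩ : Bornology.IsBounded Ω) (hΩo : IsOpen Ω)
    {D δ b H : ℝ} (hδ : 0 < δ) (hH : 0 ≤ H)
    {ν : Measure E3} [IsProbabilityMeasure ν] (hν : ∀ᵐ y ∂ν, y ∈ Lam D δ) {P R : E3 → ℝ}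
    (hR : Continuous R) (hQ : IsSteep δ b (legendre (Lam D δ) R))
    (hPQ : EqOn P (legendre (Lam D δ) R) (OmegaH Ω H))
    (hroot : ∀ x ∈ Ω, root (legendre (Lam D δ) R) x < H)
    {h : E2 → ℝ} {γ : Measure (E3 × E3)} (ha : Admissible Ω ν h γ)
    (hE : energy γ = ((∫ y, excess R y ∂ν + ∫ x, excess (legendre (Lam D δ) R) x
          ∂sigma Ω (surface (legendre (Lam D δ) R) H) : ℝ) : EReal)) :
    EqOn h (surface (legendre (Lam D δ) R) H) Ω ∧
      γ = (sigma Ω h).map fun x => (x, gradient P x) := by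
  have hL := isCompact_Lam D δ
  set Q := legendre (Lam D δ) R with hQdef
  have hcost : Integrable (fun p => cost p.1 p.2) γ := by
    by_contra hcost
    rw [ha.energy_eq_top hΩo hδ hν hcost] at hE
    exact EReal.coe_ne_top _ hE.symm
  rw [energy, extIntegral_eq_integral hcost, EReal.coe_eq_coe_iff] at hE
  have hiR : Integrable (excess R) ν := integrable_of_continuous_of_ae_mem hν hL (by
    unfold excess
    fun_prop)
  have hsl : ∀ x, ∀ y ∈ Lam D δ, inner ℝ x y ≤ Q x + R y := fun x y hy => by
    linarith [le_legendre_of_continuous hL hR x hy]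
  have hiQ := ha.integrable_excess hΩ hΩo hν hcost hδ hQ hsl hiR
  obtain ⟨hsi, h2⟩ := ha.integral_cost_eq hcost hiQ hiR
  have hslae : 0 ≤ᵐ[γ] fun p : E3 × E3 => Q p.1 + R p.2 - inner ℝ p.1 p.2 :=
    (ha.ae_mem hΩo hν).mono fun p hp => sub_nonneg.2 (hsl p.1 p.2 hp.2)
  have h3 := integral_nonneg_of_ae hslae
  have hh : ∀ x ∈ Ω, h x ≤ H ∨ root Q x < H := fun x hx => Or.inr (hroot x hx)
  have h4 := hQ.integral_surface_le hδ hΩ hΩo.measurableSet hH hh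
    (isOpen_subgraph hΩo ha.continuousOn).measurableSet hiQ
  have heq : EqOn h (surface Q H) Ω :=
    hQ.eqOn_surface hδ hΩ hΩo hH hh ha.continuousOn ha.nonneg hiQ (by linarith)
  have h5 := (integral_eq_zero_iff_of_nonneg_ae hslae hsi).1 (by linarith)
  refine ⟨heq, ?_⟩
  have hhH : ∀ x ∈ Ω, h x ≤ H := fun x hx => (heq hx).le.trans (surface_le Q hH x)
  have h6 : ∀ᵐ x ∂γ.fst, DifferentiableAt ℝ Q x ∧ gradient P x = gradient Q x := by
    rw [ha.fst_eq]
    filter_upwards [hQ.ae_differentiableAt Ω h, ae_gradient_eq hΩo ha.continuousOn hhH hPQ]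
      with x h7 h8 using ⟨h7, h8⟩
  rw [← ha.fst_eq]
  refine eq_map_fst_of_ae_eq (measurable_gradient P) ?_
  filter_upwards [ae_of_ae_map measurable_fst.aemeasurable h6, h5, ha.ae_mem hΩo hν]
    with p hp1 hp2 hp3
  have hp2' : Q p.1 + R p.2 - inner ℝ p.1 p.2 = 0 := hp2
  rw [hp1.2]
  exact (eq_gradient_of_contact hL hR hp1.1 hp3.2 (by linarith)).symm

/-- If a plan is concentrated on contact points and its second marginal is absolutely continuous,
then the gradient of the dual potential inverts it almost everywhere. -/
theorem map_gradient_right {γ : Measure (E3 × E3)} {ν : Measure E3} (hsnd : γ.snd = ν)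
    (hac : ν.AbsolutelyContinuous volume) {L : Set E3} (hL : Convex ℝ L) {A : Set E3}
    (hfst : ∀ᵐ p ∂γ, p.1 ∈ A) {K : NNReal} {P R R' : E3 → ℝ} (hR' : LipschitzWith K R')
    (hRR' : EqOn R R' L) (hPR : ∀ x ∈ A, ∀ y, inner ℝ x y - P x ≤ R' y)
    (hcontact : ∀ᵐ p ∂γ, p.2 ∈ L ∧ inner ℝ p.1 p.2 - P p.1 = R' p.2) :
    ν.map (gradient R) = γ.fst := by
  have h1 : ∀ᵐ y ∂γ.snd, DifferentiableAt ℝ R' y ∧ y ∉ frontier L := by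
    rw [hsnd]
    refine hac.ae_le ?_
    filter_upwards [hR'.ae_differentiableAt, measure_eq_zero_iff_ae_notMem.1
      (hL.addHaar_frontier volume)] with y h2 h3 using ⟨h2, h3⟩
  have h2 : ∀ᵐ p ∂γ, gradient R p.2 = p.1 := by
    filter_upwards [ae_of_ae_map measurable_snd.aemeasurable h1, hfst, hcontact] with p h3 h4 h5
    have h6 : p.2 ∈ interior L := by
      by_contra h
      exact h3.2 ⟨subset_closure h5.1, h⟩
    rw [(hRR'.eventuallyEq_of_mem (mem_interior_iff_mem_nhds.1 h6)).gradient_eq]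
    refine gradient_eq_of_touching (c := P p.1) h3.1 (Filter.Eventually.of_forall fun z => ?_) ?_
    · rw [real_inner_comm]
      exact hPR _ h4 z
    · rw [real_inner_comm]
      exact h5.2
  rw [← hsnd, Measure.snd, Measure.map_map (measurable_gradient R) measurable_snd, Measure.fst]
  exact Measure.map_congr h2

/-- Eliminating the potential and the height: if `R₀` is a continuous extension of `R` from `Λ`,
then `R₀` maximizes `R' ↦ ∫ (½(y₁² + y₂²) - R') dν + ∫ (½(x₁² + x₂²) - Q') σ` over the continuous
`R'`, where `Q'` is the conjugate of `R'` and `σ` the fluid measure below the free surface of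
`Q'`. -/
theorem IsDualMaximizer.reduced_le {Ω : Set E2} (hΩ : Bornology.IsBounded Ω) (hΩo : IsOpen Ω)
    {D δ b H : ℝ} (hδ : 0 < δ) (hH : 0 ≤ H) (hne : (Lam D δ).Nonempty)
    (hb : ∀ y ∈ Lam D δ, ‖horiz y‖ ≤ b) {ν : Measure E3} [IsProbabilityMeasure ν]
    (hν : ∀ᵐ y ∂ν, y ∈ Lam D δ) {P R R₀ : E3 → ℝ} (hR₀ : Continuous R₀)
    (hRR₀ : EqOn R R₀ (Lam D δ)) (hPQ : EqOn P (legendre (Lam D δ) R₀) (OmegaH Ω H))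
    (hmax : IsDualMaximizer Ω H (Lam D δ) ν P R) :
    dual Ω H (Lam D δ) ν P R = ((∫ y, excess R₀ y ∂ν + ∫ x, excess (legendre (Lam D δ) R₀) x
          ∂sigma Ω (surface (legendre (Lam D δ) R₀) H) : ℝ) : EReal) ∧
    ∀ R' : E3 → ℝ, Continuous R' →
      ∫ y, excess R' y ∂ν + ∫ x, excess (legendre (Lam D δ) R') x
          ∂sigma Ω (surface (legendre (Lam D δ) R') H) ≤
        ∫ y, excess R₀ y ∂ν + ∫ x, excess (legendre (Lam D δ) R₀) x
          ∂sigma Ω (surface (legendre (Lam D δ) R₀) H) := by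
  have hL := isCompact_Lam D δ
  have hνr : ν.restrict (Lam D δ) = ν := Measure.restrict_eq_self_of_ae_mem hν
  have hsteep : ∀ R' : E3 → ℝ, Continuous R' → IsSteep δ b (legendre (Lam D δ) R') := by
    intro R' hR'
    obtain ⟨c, hc⟩ := hL.bddBelow_image hR'.continuousOn
    exact IsSteep.legendre_Lam hne hb (c := c) fun y hy => hc ⟨y, hy, rfl⟩
  have hint : ∀ R' : E3 → ℝ, Continuous R' → Integrable (excess R') ν := fun R' hR' =>
    integrable_of_continuous_of_ae_mem hν hL (by
      unfold excess
      fun_prop)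
  have hae : excess R₀ =ᵐ[ν] excess R := hν.mono fun y hy => by rw [excess, excess, hRR₀ hy]
  have hd : dual Ω H (Lam D δ) ν P R = ((∫ y, excess R₀ y ∂ν +
      ∫ x, excess (legendre (Lam D δ) R₀) x
          ∂sigma Ω (surface (legendre (Lam D δ) R₀) H) : ℝ) : EReal) := by
    rw [dual_eq hΩ hΩo.measurableSet hδ hH hνr (hsteep R₀ hR₀) hPQ ((hint R₀ hR₀).congr hae),
      integral_congr_ae hae]
  refine ⟨hd, fun R' hR' => ?_⟩
  have h1 := hmax.2 (legendre (Lam D δ) R') R'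
    { aemeasurable_left := (hsteep R' hR').continuous.measurable.aemeasurable
      aemeasurable_right := hR'.measurable.aemeasurable
      inner_le := fun x _ y hy => by linarith [le_legendre_of_continuous hL hR' x hy] }
  rwa [hd, dual_eq hΩ hΩo.measurableSet hδ hH hνr (hsteep R' hR') (eqOn_refl _ _) (hint R' hR'),
    EReal.coe_le_coe_iff] at h1

end Geostrophic

open Geostrophic in
theorem theorem2p18 (Ω : Set Geostrophic.E2) (hΩo : IsOpen Ω) (hΩne : Ω.Nonempty)
    (hΩc : Convex ℝ Ω) (D δ H : ℝ) (hδ : 0 < δ) (hΩD : Ω ⊆ Metric.closedBall 0 D)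
    (hH : 2 / (MeasureTheory.volume Ω).toReal +
        (2 * sSup ((fun x : Geostrophic.E2 => ‖x‖) '' Ω) +
          sSup ((fun y : Geostrophic.E3 => |y 0| + |y 1|) '' Geostrophic.Lam D δ)) / δ *
            Metric.diam Ω < H)
    (ν : MeasureTheory.Measure Geostrophic.E3) [MeasureTheory.IsProbabilityMeasure ν]
    (hν : ν.support ⊆ Geostrophic.Lam D δ) :
    (∀ (h : Geostrophic.E2 → ℝ) (γ : MeasureTheory.Measure (Geostrophic.E3 × Geostrophic.E3))
        (P R : Geostrophic.E3 → ℝ),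
        Geostrophic.Admissible Ω ν h γ →
        Geostrophic.DualAdmissible Ω H (Geostrophic.Lam D δ) ν P R →
        Geostrophic.dual Ω H (Geostrophic.Lam D δ) ν P R ≤ Geostrophic.energy γ) ∧
    ∀ P R : Geostrophic.E3 → ℝ,
      Geostrophic.IsDualMaximizer Ω H (Geostrophic.Lam D δ) ν P R →
      Geostrophic.ConvexConjugate (Geostrophic.OmegaH Ω H) (Geostrophic.Lam D δ) P R →
      (∀ (h : Geostrophic.E2 → ℝ)
          (γ : MeasureTheory.Measure (Geostrophic.E3 × Geostrophic.E3)),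
          (Geostrophic.Admissible Ω ν h γ ∧
              Geostrophic.energy γ = Geostrophic.dual Ω H (Geostrophic.Lam D δ) ν P R) ↔
            (Set.EqOn h (Geostrophic.height P H) Ω ∧
              γ = (Geostrophic.sigma Ω h).map (fun x => (x, gradient P x)))) ∧
      (ν.AbsolutelyContinuous MeasureTheory.volume →
        ν.map (gradient R) = Geostrophic.sigma Ω (Geostrophic.height P H)) := by
  have hΩ : Bornology.IsBounded Ω := Metric.isBounded_closedBall.subset hΩD
  have hνae : ∀ᵐ y ∂ν, y ∈ Lam D δ :=
    Filter.mem_of_superset Measure.support_mem_ae hν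
  have hne : (Lam D δ).Nonempty :=
    (Measure.nonempty_support (IsProbabilityMeasure.ne_zero ν)).mono hν
  have hL := isCompact_Lam D δ
  set M := sSup ((fun x : E2 => ‖x‖) '' Ω) with hMdef
  set b := sSup ((fun y : E3 => |y 0| + |y 1|) '' Lam D δ) with hbdef
  have hM : ∀ x ∈ Ω, ‖x‖ ≤ M := fun x hx =>
    le_csSup ⟨D, by
      rintro _ ⟨z, hz, rfl⟩
      simpa using hΩD hz⟩ ⟨x, hx, rfl⟩
  have hb : ∀ y ∈ Lam D δ, ‖horiz y‖ ≤ b := fun y hy =>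
    (norm_horiz_le y).trans (le_csSup (hL.bddAbove_image (by fun_prop)) ⟨y, hy, rfl⟩)
  have hb0 : 0 ≤ b := (norm_nonneg _).trans (hb _ hne.choose_spec)
  obtain ⟨x₀, hx₀⟩ := hΩne
  have hM0 : 0 ≤ M := (norm_nonneg _).trans (hM _ hx₀)
  have hvol : 0 < (volume Ω).toReal :=
    ENNReal.toReal_pos (hΩo.measure_pos volume ⟨x₀, hx₀⟩).ne' hΩ.measure_lt_top.ne
  have hdiam : 0 ≤ Metric.diam Ω := Metric.diam_nonneg
  have hHd : 2 / (volume Ω).toReal + (M + b) / δ * Metric.diam Ω ≤ H := by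
    refine le_trans ?_ hH.le
    gcongr
    linarith
  have hH2 : 2 / (volume Ω).toReal ≤ H := by
    have : 0 ≤ (M + b) / δ * Metric.diam Ω := by positivity
    linarith
  have hH0 : 0 ≤ H := le_trans (by positivity) hH2
  have hHv : 1 ≤ (volume Ω).toReal * H := by
    rw [div_le_iff₀ hvol] at hH2
    linarith
  refine ⟨fun h γ P R ha hPR =>
    dual_le_energy hΩ hΩo ⟨x₀, hx₀⟩ hδ hne hb hM hHd hH0 hHv hνae ha hPR, ?_⟩
  intro P R hmax hconj
  have hAne : (OmegaH Ω H).Nonempty := ⟨lift x₀ 0, by rwa [horiz_lift], le_rfl, hH0⟩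
  have hAb := isBounded_OmegaH hΩ H
  -- both conjugate functions are bounded below on bounded sets
  have hPlow : ∃ c, ∀ x ∈ OmegaH Ω H, c ≤ P x := by
    obtain ⟨y, hy⟩ := hne
    obtain ⟨C, hC⟩ := hAb.isCompact_closure.exists_bound_of_continuousOn
      (f := fun x : E3 => inner ℝ x y) (by fun_prop)
    exact ⟨-C - R y, fun x hx => by
      linarith [neg_le_of_abs_le (hC x (subset_closure hx)), hmax.1.inner_le x hx y hy]⟩
  obtain ⟨cP, hcP⟩ := hPlow
  obtain ⟨K, hK⟩ := exists_lipschitzWith_legendre hAb hAne hcP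
  set R₀ := legendre (OmegaH Ω H) P with hR₀
  have hRR₀ : Set.EqOn R R₀ (Lam D δ) := hconj.symm.eqOn_legendre hAne
  have hPQ : Set.EqOn P (legendre (Lam D δ) R₀) (OmegaH Ω H) := by
    rw [← legendre_congr hRR₀]
    exact hconj.eqOn_legendre hne
  set Q := legendre (Lam D δ) R₀ with hQdef
  have hQ : IsSteep δ b Q := by
    obtain ⟨c, hc⟩ := hL.bddBelow_image hK.continuous.continuousOn
    exact IsSteep.legendre_Lam hne hb (c := c) fun y hy => hc ⟨y, hy, rfl⟩
  obtain ⟨hdual, hred⟩ :=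
    hmax.reduced_le hΩ hΩo hδ hH0 hne hb hνae hK.continuous hRR₀ hPQ
  have hmap := map_gradient_eq hΩ hΩo hδ hH0 hne hb hνae hK.continuous hred
  have hroot : ∀ x ∈ Ω, root Q x < H := fun x hx =>
    hQ.root_lt hδ hb0 hΩ hΩo hM hH0 hHd
      (hQ.integral_surface_eq_one hδ hΩ hΩo.measurableSet hmap) hx
  have hheight : Set.EqOn (height P H) (surface Q H) Ω :=
    height_eq_surface hH0 hδ hconj hQ hPQ
  refine ⟨fun h γ => ⟨fun ⟨ha, hE⟩ => ?_, fun ⟨hh, hγ⟩ => ?_⟩, fun hac => ?_⟩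
  · obtain ⟨h1, h2⟩ := ha.eq_graph hΩ hΩo hδ hH0 hνae hK.continuous hQ hPQ hroot (hE.trans hdual)
    exact ⟨h1.trans hheight.symm, h2⟩
  · obtain ⟨h1, -, h2⟩ := admissible_graph hΩ hΩo hδ hH0 hL hne hνae hK.continuous hQ hPQ hmap
      (hh.trans hheight)
    rw [hγ]
    exact ⟨h1, h2.trans hdual.symm⟩
  · obtain ⟨h1, h2, -⟩ := admissible_graph hΩ hΩo hδ hH0 hL hne hνae hK.continuous hQ hPQ hmap
      hheight
    have hmem : ∀ᵐ p ∂(sigma Ω (height P H)).map fun x => (x, gradient P x),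
        p.1 ∈ OmegaH Ω H := (h1.ae_mem hΩo hνae).mono fun p hp =>
      subgraph_subset_OmegaH (fun x hx => (hheight hx).le.trans (surface_le Q hH0 x)) hp.1
    rw [← h1.fst_eq]
    refine map_gradient_right h1.snd_eq hac (convex_Lam D δ) hmem (P := P) hK hRR₀ ?_ ?_
    · intro x hx y
      have := le_legendre hAb hcP y hx
      rwa [real_inner_comm] at this
    · filter_upwards [h2, hmem] with p hp hp'
      exact ⟨hp.1, by linarith [hp.2, hPQ hp']⟩
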